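/- For permutations $\sigma=\sigma_1\cdots\sigma_m$ of $\{1,\dots,m\}$ and $\pi=\pi_1\cdots\pi_n$ of $\{1,\dots,n\}$, let $n_\sigma(\pi)$ be the number of occurrences of $\sigma$ in $\pi$, i.e. the number of sequences $1\le i_1<\dots<i_m\le n$ such that $\pi_{i_j}<\pi_{i_k}\iff\sigma_j<\sigma_k$ for all $j,k\in\{1,\dots,m\}$. Let $\mathfrak S_n(132,312)$ be the set of permutations $\pi$ of $\{1,\dots,n\}$ with $n_{132}(\pi)=n_{312}(\pi)=0$, and let $\boldsymbol\pi_n$ be a uniformly random element of $\mathfrak S_n(132,312)$. Let $m\ge1$ and $\sigma\in\mathfrak S_m(132,312)$. For $2\le j\le m$, let $\eta_j=1$ if $\sigma_j>\sigma_i$ for all $i<j$, and $\eta_j=-1$ otherwise (in which case $\sigma_j<\sigma_i$ for all $i<j$). Let $$\gamma^2=2^{2-2m}\sum_{i,j=2}^m\frac{(i+j-2)!\,(2m-i-j)!}{(i-1)!\,(j-1)!\,(m-i)!\,(m-j)!\,(2m-1)!}\,\eta_i\eta_j .$$ Then $\gamma^2\ge0$, with $\gamma^2>0$ if $m\ge2$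 (for $m=1$ the sum is empty and $\gamma^2=0$), and, as $n\to\infty$, $$\frac{n_\sigma(\boldsymbol\pi_n)-2^{1-m}n^m/m!}{n^{m-1/2}}\ \xrightarrow{\ d\ }\ N(0,\gamma^2),$$ where $N(0,0)$ denotes the point mass at $0$. Moreover, all moments converge: for every integer $k\ge0$, the $k$-th moment of the left-hand side converges to the $k$-th moment of $N(0,\gamma^2)$. -/

import Mathlib

open MeasureTheory ProbabilityTheory Filter Topology
open scoped Nat

namespace PatternCount

/-- The number of occurrences of the pattern `σ` in the permutation `π`: the number of strictly
increasing index sequences `e 0 < e 1 < ⋯ < e (m - 1)` such that the values of `π` along `e` are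
in the same relative order as those of `σ`. A permutation of `{1, …, n}` is represented as a
permutation of `Fin n = {0, …, n - 1}`, that is, positions and values are both shifted by one. -/
def occ {m n : ℕ} (σ : Equiv.Perm (Fin m)) (π : Equiv.Perm (Fin n)) : ℕ :=
  (Finset.univ.filter fun e : Fin m → Fin n =>
    (∀ j k, j < k → e j < e k) ∧ ∀ j k, π (e j) < π (e k) ↔ σ j < σ k).card

/-- The permutation `132`. -/
def perm132 : Equiv.Perm (Fin 3) where
  toFun := ![0, 2, 1]
  invFun := ![0, 2, 1]
  left_inv := by decide
  right_inv := by decide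

/-- The permutation `312`. -/
def perm312 : Equiv.Perm (Fin 3) where
  toFun := ![2, 0, 1]
  invFun := ![1, 2, 0]
  left_inv := by decide
  right_inv := by decide

/-- The set of permutations of length `n` that avoid both `132` and `312`. -/
def avoiders (n : ℕ) : Set (Equiv.Perm (Fin n)) :=
  {π | occ perm132 π = 0 ∧ occ perm312 π = 0}

theorem one_mem_avoiders (n : ℕ) : (1 : Equiv.Perm (Fin n)) ∈ avoiders n := by
  constructor
  · refine Finset.card_eq_zero.mpr (Finset.filter_eq_empty_iff.mpr ?_)
    rintro e - ⟨he, h⟩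
    exact absurd ((h 1 2).1 (he 1 2 (by decide))) (by decide)
  · refine Finset.card_eq_zero.mpr (Finset.filter_eq_empty_iff.mpr ?_)
    rintro e - ⟨he, h⟩
    exact absurd ((h 0 1).1 (he 0 1 (by decide))) (by decide)

/-- Every set of permutations of length `n` is an event. -/
instance measurableSpacePerm (n : ℕ) : MeasurableSpace (Equiv.Perm (Fin n)) := ⊤

instance measurableSingletonClassPerm (n : ℕ) :
    MeasurableSingletonClass (Equiv.Perm (Fin n)) where
  measurableSet_singleton _ := trivial

/-- The law of a uniformly random permutation of length `n` that avoids `{132, 312}`. -/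
noncomputable def uniformAvoider (n : ℕ) : Measure (Equiv.Perm (Fin n)) :=
  uniformOn (avoiders n)

instance isProbabilityMeasure_uniformAvoider (n : ℕ) :
    IsProbabilityMeasure (uniformAvoider n) :=
  isProbabilityMeasure_uniformOn (Set.toFinite _) ⟨1, one_mem_avoiders n⟩

/-- The code `η` of a permutation `σ` avoiding `{132, 312}`: it is `1` at the position `j` if the
entry `σ j` is larger than all earlier entries, and `-1` otherwise (every entry of such a `σ` is
larger than all earlier entries or smaller than all earlier entries). Only positions after the
first one are used. -/
def code {m : ℕ} (σ : Equiv.Perm (Fin m)) (j : Fin m) : ℤ :=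
  if ∀ i, i < j → σ i < σ j then 1 else -1

/-- The asymptotic variance `γ²`,
`2^(2-2m) ∑_{i,j=2}^m (i+j-2)! (2m-i-j)! / ((i-1)! (j-1)! (m-i)! (m-j)! (2m-1)!) η_i η_j`,
written with the shifted indices `i - 1, j - 1 ∈ {1, …, m - 1}`. -/
noncomputable def gammaSq {m : ℕ} (σ : Equiv.Perm (Fin m)) : ℝ :=
  (2 : ℝ) ^ (2 - 2 * (m : ℤ)) *
    ∑ i : Fin m, ∑ j : Fin m,
      if 0 < (i : ℕ) ∧ 0 < (j : ℕ) then
        ((((i : ℕ) + j)! : ℝ) * ((2 * m - 2 - i - j)! : ℝ)) /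
          (((i : ℕ)! : ℝ) * ((j : ℕ)! : ℝ) * ((m - 1 - i)! : ℝ) * ((m - 1 - j)! : ℝ) *
            ((2 * m - 1)! : ℝ)) * (code σ i : ℝ) * (code σ j : ℝ)
      else 0

/-- The normalized number of occurrences of `σ` in a permutation of length `n`:
`(n_σ(π) - 2^(1-m) n^m / m!) / n^(m-1/2)`. -/
noncomputable def normalizedOcc {m : ℕ} (σ : Equiv.Perm (Fin m)) (n : ℕ)
    (π : Equiv.Perm (Fin n)) : ℝ :=
  ((occ σ π : ℝ) - (2 : ℝ) ^ (1 - (m : ℤ)) * (n : ℝ) ^ m / (m ! : ℝ)) /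
    (n : ℝ) ^ ((m : ℝ) - 1 / 2)

end PatternCount

/-! A permutation avoids 132 and 312 exactly when every entry is larger or smaller than all earlier
entries. These choices are free after the first position and determine the permutation, so a uniform
avoider is a sequence of independent fair bits. Adding an irrelevant bit at the first position makes
it the image of a uniform point of the cube under `codePerm`. An increasing sequence is an
occurrence of `σ` iff the bits along it, except the first, are those of `σ`. Hence the count is the
`U`-statistic `uStat (kernel σ)` of independent signs (`occ_codePerm`, `integral_uniformAvoider`).

For a function `f` on the cube, compare `f` with its mean plus the linear form with coefficients
`cubeAvg (cubeDeriv i f)`. The Poincaré inequality, used twice, bounds the mean square error by the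
second differences (`cubeAvg_sq_sub_linear_le`). For the `U`-statistic these are O(n^(m-2)), so the
squared error is O(n^(2m-2)), negligible against n^(2m-1). The linear coefficients, divided by
n^(m-1), follow the polynomial `limCoeff` at i/n. The variance of the linear part is thus a Riemann
sum for the integral of `limCoeff ^ 2`, which Beta integrals identify with γ²
(`gammaSq_eq_integral`); this also gives its sign. The linear part has characteristic function ∏
cos(t bᵢ), with Gaussian limit (`tendsto_cubeAvg_cexp_linear`).

For moments, first differences of the normalized count are O(n^(-1/2)), so bounded differences bound
all even moments uniformly in n (`cubeAvg_normStat_pow_le`). Truncation then upgrades weak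
convergence to convergence of moments (`tendsto_integral_pow`). -/

namespace PatternCount

/-! ### Averages and differences on the discrete cube -/

/-- The average of a function on the discrete cube. -/
noncomputable def cubeAvg {K : Type*} [Field K] {n : ℕ} (f : (Fin n → Bool) → K) : K :=
  (∑ ξ, f ξ) / 2 ^ n

/-- The discrete derivative in the direction `i` of a function on the discrete cube. -/
noncomputable def cubeDeriv {n : ℕ} (i : Fin n) (f : (Fin n → Bool) → ℝ) (ξ : Fin n → Bool) : ℝ :=
  (f (Function.update ξ i true) - f (Function.update ξ i false)) / 2

section Average

variable {K : Type*} [Field K] {n : ℕ}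

theorem cubeAvg_add (f g : (Fin n → Bool) → K) :
    cubeAvg (fun ξ => f ξ + g ξ) = cubeAvg f + cubeAvg g := by
  simp [cubeAvg, Finset.sum_add_distrib, add_div]

theorem cubeAvg_sub (f g : (Fin n → Bool) → K) :
    cubeAvg (fun ξ => f ξ - g ξ) = cubeAvg f - cubeAvg g := by
  simp [cubeAvg, Finset.sum_sub_distrib, sub_div]

theorem cubeAvg_const_mul (c : K) (f : (Fin n → Bool) → K) :
    cubeAvg (fun ξ => c * f ξ) = c * cubeAvg f := by
  simp [cubeAvg, ← Finset.mul_sum, mul_div_assoc]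

theorem cubeAvg_sum {ι : Type*} (s : Finset ι) (f : ι → (Fin n → Bool) → K) :
    cubeAvg (fun ξ => ∑ i ∈ s, f i ξ) = ∑ i ∈ s, cubeAvg (f i) := by
  simp only [cubeAvg]
  rw [Finset.sum_comm, Finset.sum_div]

theorem cubeAvg_const [CharZero K] (c : K) : cubeAvg (fun _ : Fin n → Bool => c) = c := by
  simp [cubeAvg]

theorem cubeAvg_cons [CharZero K] (f : (Fin (n + 1) → Bool) → K) :
    cubeAvg f = (cubeAvg (fun ζ => f (Fin.cons true ζ)) +
      cubeAvg (fun ζ => f (Fin.cons false ζ))) / 2 := by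
  have h : ∑ ξ, f ξ = ∑ ζ, f (Fin.cons true ζ) + ∑ ζ, f (Fin.cons false ζ) := by
    rw [← (Fin.consEquiv fun _ => Bool).sum_comp, Fintype.sum_prod_type]
    simp [Fin.consEquiv]
  simp only [cubeAvg, h]
  field_simp
  ring

/-- The average of a product of functions of the individual coordinates. -/
theorem cubeAvg_prod [CharZero K] (h : Fin n → Bool → K) :
    cubeAvg (fun ξ => ∏ i, h i (ξ i)) = ∏ i, (h i true + h i false) / 2 := by
  have := Finset.prod_univ_sum (fun _ : Fin n => (Finset.univ : Finset Bool)) h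
  rw [Fintype.piFinset_univ] at this
  rw [cubeAvg, ← this, Finset.prod_div_distrib]
  simp

/-- Distinct coordinates of a uniform point of the cube are jointly uniform. -/
theorem cubeAvg_comp_injective [CharZero K] {m : ℕ} {e : Fin m → Fin n}
    (he : Function.Injective e) (G : (Fin m → Bool) → K) :
    cubeAvg (fun ξ : Fin n → Bool => G (ξ ∘ e)) = cubeAvg G := by
  -- Averages are invariant under xor with a fixed `η`. Averaging over `η` and exchanging the two
  -- averages makes `η` the variable; the xor with the now fixed `ξ ∘ e` then disappears, so no
  -- fibre has to be counted.
  have shift : ∀ {l : ℕ} (F : (Fin l → Bool) → K) (η : Fin l → Bool),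
      cubeAvg (fun ξ => F (fun i => xor (ξ i) (η i))) = cubeAvg F := by
    intro l F η
    have hinv : Function.Involutive (fun (ξ : Fin l → Bool) (i : Fin l) => xor (ξ i) (η i)) := by
      intro ξ; funext i; simp
    rw [cubeAvg, cubeAvg, ← Equiv.sum_comp (hinv.toPerm _) F]
    rfl
  have h1 : ∀ η : Fin m → Bool, cubeAvg (fun ξ : Fin n → Bool => G (ξ ∘ e)) =
      cubeAvg (fun ξ : Fin n → Bool => G (fun k => xor (ξ (e k)) (η k))) := by
    intro η
    rw [← shift _ (Function.extend e η fun _ => false)]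
    simp only [Function.comp_def, he.extend_apply]
  have h2 : cubeAvg (fun ξ : Fin n → Bool => G (ξ ∘ e)) =
      cubeAvg (fun η : Fin m → Bool =>
        cubeAvg (fun ξ : Fin n → Bool => G (fun k => xor (ξ (e k)) (η k)))) := by
    simp only [← h1, cubeAvg_const]
  rw [h2]
  have h3 : cubeAvg (fun η : Fin m → Bool =>
        cubeAvg (fun ξ : Fin n → Bool => G (fun k => xor (ξ (e k)) (η k)))) =
      cubeAvg (fun ξ : Fin n → Bool =>
        cubeAvg (fun η : Fin m → Bool => G (fun k => xor (η k) (ξ (e k))))) := by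
    simp only [cubeAvg, ← Finset.sum_div]
    rw [Finset.sum_comm, div_right_comm]
    simp only [Bool.xor_comm]
  rw [h3]
  simp only [shift, cubeAvg_const]

end Average

/-! ### Variance and concentration inequalities on the cube -/

section Real

variable {n : ℕ}

theorem cubeAvg_mono {f g : (Fin n → Bool) → ℝ} (h : ∀ ξ, f ξ ≤ g ξ) :
    cubeAvg f ≤ cubeAvg g :=
  div_le_div_of_nonneg_right (Finset.sum_le_sum fun ξ _ => h ξ) (by positivity)

theorem norm_cubeAvg_le {K : Type*} [RCLike K] (f : (Fin n → Bool) → K) :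
    ‖cubeAvg f‖ ≤ cubeAvg (fun ξ => ‖f ξ‖) := by
  rw [cubeAvg, cubeAvg, norm_div, norm_pow, RCLike.norm_two]
  exact div_le_div_of_nonneg_right (norm_sum_le _ _) (by positivity)

theorem abs_cubeAvg_le {f : (Fin n → Bool) → ℝ} {c : ℝ} (h : ∀ ξ, |f ξ| ≤ c) :
    |cubeAvg f| ≤ c :=
  (norm_cubeAvg_le f).trans ((cubeAvg_mono h).trans_eq (cubeAvg_const c))

/-- The difference of the two sides is a variance. -/
theorem sq_cubeAvg_le (f : (Fin n → Bool) → ℝ) : cubeAvg f ^ 2 ≤ cubeAvg (fun ξ => f ξ ^ 2) := by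
  have h : 0 ≤ cubeAvg (fun ξ => (f ξ - cubeAvg f) ^ 2) :=
    (cubeAvg_const (0 : ℝ)).symm.trans_le (cubeAvg_mono fun ξ => sq_nonneg _)
  have h2 : cubeAvg (fun ξ => (f ξ - cubeAvg f) ^ 2) =
      cubeAvg (fun ξ => f ξ ^ 2) - 2 * cubeAvg f * cubeAvg f + cubeAvg f ^ 2 := by
    have : (fun ξ => (f ξ - cubeAvg f) ^ 2) = fun ξ =>
        f ξ ^ 2 - 2 * cubeAvg f * f ξ + cubeAvg f ^ 2 := by
      funext ξ; ring
    rw [this, cubeAvg_add, cubeAvg_sub, cubeAvg_const_mul, cubeAvg_const]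
  nlinarith

theorem cubeDeriv_const_mul (i : Fin n) (c : ℝ) (f : (Fin n → Bool) → ℝ) (ξ : Fin n → Bool) :
    cubeDeriv i (fun ξ => c * f ξ) ξ = c * cubeDeriv i f ξ := by
  simp only [cubeDeriv]; ring

theorem cubeDeriv_sum {ι : Type*} (i : Fin n) (s : Finset ι) (f : ι → (Fin n → Bool) → ℝ)
    (ξ : Fin n → Bool) :
    cubeDeriv i (fun ξ => ∑ a ∈ s, f a ξ) ξ = ∑ a ∈ s, cubeDeriv i (f a) ξ := by
  simp only [cubeDeriv, ← Finset.sum_sub_distrib, Finset.sum_div]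

theorem cubeDeriv_zero_eq (f : (Fin (n + 1) → Bool) → ℝ) (b : Bool) (ζ : Fin n → Bool) :
    cubeDeriv 0 f (Fin.cons b ζ) = (f (Fin.cons true ζ) - f (Fin.cons false ζ)) / 2 := by
  simp [cubeDeriv, Fin.update_cons_zero]

/-- The average over the first coordinate. -/
noncomputable def avgFirst (f : (Fin (n + 1) → Bool) → ℝ) (ζ : Fin n → Bool) : ℝ :=
  (f (Fin.cons true ζ) + f (Fin.cons false ζ)) / 2

theorem cubeAvg_avgFirst (f : (Fin (n + 1) → Bool) → ℝ) : cubeAvg (avgFirst f) = cubeAvg f := by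
  rw [cubeAvg_cons, ← cubeAvg_add, div_eq_inv_mul, ← cubeAvg_const_mul]
  exact congrArg cubeAvg (funext fun ζ => by simp only [avgFirst]; ring)

theorem cubeDeriv_avgFirst (i : Fin n) (f : (Fin (n + 1) → Bool) → ℝ) (ζ : Fin n → Bool) :
    cubeDeriv i (avgFirst f) ζ = avgFirst (cubeDeriv i.succ f) ζ := by
  simp only [cubeDeriv, avgFirst, Fin.cons_update]; ring

/-- The Poincaré inequality on the discrete cube. -/
theorem poincare : ∀ {n : ℕ} (f : (Fin n → Bool) → ℝ),
    cubeAvg (fun ξ => f ξ ^ 2) - cubeAvg f ^ 2 ≤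
      ∑ i, cubeAvg (fun ξ => cubeDeriv i f ξ ^ 2)
  | 0, f => by simp [cubeAvg]
  | n + 1, f => by
    -- Total variance: (a² + b²)/2 = ((a + b)/2)² + ((a - b)/2)² for the two values of the first
    -- coordinate.
    have h1 : cubeAvg (fun ξ => f ξ ^ 2) = cubeAvg (fun ζ => avgFirst f ζ ^ 2) +
        cubeAvg (fun ξ => cubeDeriv 0 f ξ ^ 2) := by
      rw [← cubeAvg_avgFirst (fun ξ => f ξ ^ 2), ← cubeAvg_avgFirst (fun ξ => cubeDeriv 0 f ξ ^ 2),
        ← cubeAvg_add]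
      refine congrArg cubeAvg (funext fun ζ => ?_)
      simp only [avgFirst, cubeDeriv_zero_eq]
      ring
    have h2 := poincare (avgFirst f)
    rw [cubeAvg_avgFirst] at h2
    -- By convexity of the square, averaging out the first coordinate only decreases the squared
    -- differences in the other directions.
    have h3 : ∀ i : Fin n, cubeAvg (fun ζ => cubeDeriv i (avgFirst f) ζ ^ 2) ≤
        cubeAvg (fun ξ => cubeDeriv i.succ f ξ ^ 2) := by
      intro i
      rw [← cubeAvg_avgFirst (fun ξ => cubeDeriv i.succ f ξ ^ 2)]
      refine cubeAvg_mono fun ζ => ?_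
      rw [cubeDeriv_avgFirst]
      simp only [avgFirst]
      nlinarith [sq_nonneg (cubeDeriv i.succ f (Fin.cons true ζ) -
        cubeDeriv i.succ f (Fin.cons false ζ))]
    rw [Fin.sum_univ_succ]
    linarith [Finset.sum_le_sum fun i (_ : i ∈ Finset.univ) => h3 i]

/-- The bounded differences inequality on the discrete cube. -/
theorem cubeAvg_exp_le : ∀ {n : ℕ} (f : (Fin n → Bool) → ℝ) (c : Fin n → ℝ)
    (_ : ∀ i ξ, |cubeDeriv i f ξ| ≤ c i),
    cubeAvg (fun ξ => Real.exp (f ξ - cubeAvg f)) ≤ Real.exp ((∑ i, c i ^ 2) / 2)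
  | 0, f, c, _ => by simp [cubeAvg]
  | n + 1, f, c, hc => by
    have h2 := cubeAvg_exp_le (avgFirst f) (fun i => c i.succ) fun i ζ => by
      rw [cubeDeriv_avgFirst, avgFirst, abs_le]
      have h1 := abs_le.1 (hc i.succ (Fin.cons true ζ))
      have h2 := abs_le.1 (hc i.succ (Fin.cons false ζ))
      constructor <;> linarith [h1.1, h1.2, h2.1, h2.2]
    rw [cubeAvg_avgFirst] at h2
    -- With the other coordinates fixed, `f` is its conditional mean plus or minus `d`, so the first
    -- coordinate contributes the factor cosh d ≤ exp(d²/2).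
    have h3 : ∀ ζ, avgFirst (fun ξ => Real.exp (f ξ - cubeAvg f)) ζ ≤
        Real.exp (c 0 ^ 2 / 2) * Real.exp (avgFirst f ζ - cubeAvg f) := by
      intro ζ
      set d := cubeDeriv 0 f (Fin.cons true ζ) with hd
      have hd' := hc 0 (Fin.cons true ζ)
      rw [← hd] at hd'
      rw [cubeDeriv_zero_eq] at hd
      have e1 : f (Fin.cons true ζ) - cubeAvg f = (avgFirst f ζ - cubeAvg f) + d := by
        rw [hd, avgFirst]; ring
      have e2 : f (Fin.cons false ζ) - cubeAvg f = (avgFirst f ζ - cubeAvg f) + -d := by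
        rw [hd, avgFirst]; ring
      have h4 : avgFirst (fun ξ => Real.exp (f ξ - cubeAvg f)) ζ =
          Real.cosh d * Real.exp (avgFirst f ζ - cubeAvg f) := by
        rw [avgFirst, e1, e2, Real.exp_add, Real.exp_add, Real.cosh_eq]; ring
      rw [h4]
      refine mul_le_mul_of_nonneg_right ((Real.cosh_le_exp_half_sq d).trans ?_)
        (Real.exp_pos _).le
      have : d ^ 2 ≤ c 0 ^ 2 := sq_le_sq' (by linarith [(abs_le.1 hd').1]) (abs_le.1 hd').2
      exact Real.exp_le_exp.2 (by linarith)
    rw [← cubeAvg_avgFirst]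
    refine (cubeAvg_mono h3).trans ?_
    rw [cubeAvg_const_mul, Fin.sum_univ_succ, add_div, Real.exp_add]
    exact mul_le_mul_of_nonneg_left h2 (Real.exp_pos _).le

/-- Bounded differences bound all even moments. -/
theorem cubeAvg_pow_le (f : (Fin n → Bool) → ℝ) (c : Fin n → ℝ)
    (hc : ∀ i ξ, |cubeDeriv i f ξ| ≤ c i) (k : ℕ) :
    cubeAvg (fun ξ => (f ξ - cubeAvg f) ^ (2 * k)) ≤
      2 * (2 * k)! * Real.exp ((∑ i, c i ^ 2) / 2) := by
  have h1 := cubeAvg_exp_le f c hc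
  have h2 := cubeAvg_exp_le (fun ξ => (-1) * f ξ) c fun i ξ => by
    rw [cubeDeriv_const_mul, abs_mul]; simpa using hc i ξ
  rw [cubeAvg_const_mul] at h2
  -- One term of the exponential series at |x|. Both signs are kept because `h1` and `h2` control
  -- both exponential moments by the same bound, whence the factor 2.
  have h3 : ∀ x : ℝ, x ^ (2 * k) ≤ (2 * k)! * (Real.exp x + Real.exp (-x)) := by
    intro x
    have h : ∀ y : ℝ, 0 ≤ y → y ^ (2 * k) ≤ (2 * k)! * Real.exp y := fun y hy => by
      have := Real.pow_div_factorial_le_exp y hy (2 * k)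
      rwa [div_le_iff₀' (by positivity)] at this
    rw [mul_add]
    rcases le_total 0 x with hx | hx
    · have := h x hx
      have : 0 ≤ (2 * k)! * Real.exp (-x) := by positivity
      linarith
    · have := h (-x) (by linarith)
      rw [Even.neg_pow (by simp)] at this
      have : 0 ≤ (2 * k)! * Real.exp x := by positivity
      linarith
  refine (cubeAvg_mono fun ξ => h3 _).trans ?_
  rw [cubeAvg_const_mul, cubeAvg_add]
  have e : cubeAvg (fun ξ => Real.exp (-(f ξ - cubeAvg f))) =
      cubeAvg (fun ξ => Real.exp (-1 * f ξ - -1 * cubeAvg f)) :=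
    congrArg cubeAvg (funext fun ξ => by congr 1; ring)
  rw [e, mul_comm (2 : ℝ), mul_assoc]
  gcongr
  linarith

/-- The sign `1` or `-1` of a bit. -/
def sgn (b : Bool) : ℝ := if b then 1 else -1

/-- The mean square distance between a function on the cube and its linear approximation is bounded
by its second differences. -/
theorem cubeAvg_sq_sub_linear_le (f : (Fin n → Bool) → ℝ) :
    cubeAvg (fun ξ => (f ξ - cubeAvg f - ∑ i, cubeAvg (cubeDeriv i f) * sgn (ξ i)) ^ 2) ≤
      ∑ i, ∑ j, cubeAvg (fun ξ => cubeDeriv j (cubeDeriv i f) ξ ^ 2) := by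
  set a : Fin n → ℝ := fun i => cubeAvg (cubeDeriv i f) with ha
  set g : (Fin n → Bool) → ℝ := fun ξ => f ξ - cubeAvg f - ∑ i, a i * sgn (ξ i) with hg
  have hs : ∀ i : Fin n, cubeAvg (fun ξ => sgn (ξ i)) = 0 := by
    intro i
    have := cubeAvg_comp_injective (e := fun _ : Fin 1 => i)
      (Function.injective_of_subsingleton _) (fun ζ => sgn (ζ 0))
    simp only [Function.comp] at this
    rw [this, cubeAvg_cons]
    simp [sgn, cubeAvg]
  have h0 : cubeAvg g = 0 := by
    simp only [hg, cubeAvg_sub, cubeAvg_const, cubeAvg_sum, cubeAvg_const_mul, hs]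
    simp
  have hD : ∀ i ξ, cubeDeriv i g ξ = cubeDeriv i f ξ - a i := by
    intro i ξ
    have h1 : ∑ j, a j * sgn (Function.update ξ i true j) -
        ∑ j, a j * sgn (Function.update ξ i false j) = 2 * a i := by
      rw [← Finset.sum_sub_distrib, Finset.sum_eq_single i]
      · simp [sgn]; ring
      · intro j _ hj; simp [Function.update_of_ne hj]
      · simp
    simp only [cubeDeriv, hg]
    linarith
  -- The differences of `g` are those of `f` minus their means, so their mean squares are variances
  -- and Poincaré applies to them again.
  have h1 := poincare g
  rw [h0] at h1
  have h2 : ∀ i, cubeAvg (fun ξ => cubeDeriv i g ξ ^ 2) ≤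
      ∑ j, cubeAvg (fun ξ => cubeDeriv j (cubeDeriv i f) ξ ^ 2) := by
    intro i
    refine le_trans (le_of_eq ?_) (poincare (cubeDeriv i f))
    have : (fun ξ => cubeDeriv i g ξ ^ 2) = fun ξ =>
        cubeDeriv i f ξ ^ 2 - 2 * a i * cubeDeriv i f ξ + a i ^ 2 := by
      funext ξ; rw [hD]; ring
    rw [this, cubeAvg_add, cubeAvg_sub, cubeAvg_const_mul, cubeAvg_const]
    simp only [ha]; ring
  linarith [Finset.sum_le_sum fun i (_ : i ∈ Finset.univ) => h2 i]

end Real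

/-! ### Counting sequences through prescribed points -/

/-- The strictly increasing sequences of length `m` in `Fin n`. -/
def increasingSeqs (m n : ℕ) : Finset (Fin m → Fin n) :=
  Finset.univ.filter fun e => ∀ j k, j < k → e j < e k

section Counting

variable {m n : ℕ}

theorem strictMono_of_mem {e : Fin m → Fin n} (he : e ∈ increasingSeqs m n) : StrictMono e :=
  fun _ _ h => (Finset.mem_filter.1 he).2 _ _ h

theorem mem_increasingSeqs {e : Fin m → Fin n} : e ∈ increasingSeqs m n ↔ StrictMono e :=
  ⟨strictMono_of_mem, fun h => Finset.mem_filter.2 ⟨Finset.mem_univ _, fun _ _ hjk => h hjk⟩⟩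

theorem card_increasingSeqs : (increasingSeqs m n).card = n.choose m := by
  have : n.choose m = (Finset.powersetCard m (Finset.univ : Finset (Fin n))).card := by simp
  rw [this]
  refine Finset.card_bij (fun e _ => Finset.univ.image e) ?_ ?_ ?_
  · intro e he
    simp [Finset.mem_powersetCard, Finset.card_image_of_injective _ (strictMono_of_mem he).injective]
  · intro e he e' he' h
    refine ((strictMono_of_mem he).range_inj (strictMono_of_mem he')).1 ?_
    have := congrArg (fun s : Finset (Fin n) => (s : Set (Fin n))) h
    simpa using this
  · intro s hs
    have hc := (Finset.mem_powersetCard.1 hs).2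
    refine ⟨s.orderEmbOfFin hc, mem_increasingSeqs.2 (s.orderEmbOfFin hc).strictMono, ?_⟩
    exact s.image_orderEmbOfFin_univ hc

theorem image_Iio_of_strictMono {e : Fin m → Fin n} (he : StrictMono e) (k : Fin m) :
    (Finset.univ.image e).filter (· < e k) = (Finset.Iio k).image e := by
  ext x
  simp only [Finset.mem_filter, Finset.mem_image, Finset.mem_univ, true_and, Finset.mem_Iio]
  constructor
  · rintro ⟨⟨a, rfl⟩, h⟩
    exact ⟨a, he.lt_iff_lt.1 h, rfl⟩
  · rintro ⟨a, h, rfl⟩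
    exact ⟨⟨a, rfl⟩, he h⟩

theorem image_Ioi_of_strictMono {e : Fin m → Fin n} (he : StrictMono e) (k : Fin m) :
    (Finset.univ.image e).filter (e k < ·) = (Finset.Ioi k).image e := by
  ext x
  simp only [Finset.mem_filter, Finset.mem_image, Finset.mem_univ, true_and, Finset.mem_Ioi]
  constructor
  · rintro ⟨⟨a, rfl⟩, h⟩
    exact ⟨a, he.lt_iff_lt.1 h, rfl⟩
  · rintro ⟨a, h, rfl⟩
    exact ⟨⟨a, rfl⟩, he h⟩

/-- The number of increasing sequences with a prescribed value at a prescribed place. -/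
theorem card_increasingSeqs_eq (k : Fin m) (i : Fin n) :
    ((increasingSeqs m n).filter fun e => e k = i).card =
      (i : ℕ).choose k * (n - 1 - i).choose (m - 1 - k) := by
  -- A sequence with `e k = i` amounts to a set of `k` points below `i` and a set of `m - 1 - k`
  -- points above.
  have hT : (i : ℕ).choose k * (n - 1 - i).choose (m - 1 - k) =
      (Finset.powersetCard (k : ℕ) (Finset.Iio i) ×ˢ
        Finset.powersetCard (m - 1 - k) (Finset.Ioi i)).card := by
    rw [Finset.card_product, Finset.card_powersetCard, Finset.card_powersetCard, Fin.card_Iio,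
      Fin.card_Ioi]
  rw [hT]
  refine Finset.card_bij (fun e _ => ((Finset.Iio k).image e, (Finset.Ioi k).image e)) ?_ ?_ ?_
  · intro e he
    obtain ⟨he', rfl⟩ := Finset.mem_filter.1 he
    have hm := strictMono_of_mem he'
    rw [Finset.mem_product, Finset.mem_powersetCard, Finset.mem_powersetCard,
      Finset.card_image_of_injective _ hm.injective, Finset.card_image_of_injective _ hm.injective,
      Fin.card_Iio, Fin.card_Ioi]
    refine ⟨⟨?_, rfl⟩, ?_, rfl⟩
    · exact Finset.image_subset_iff.2 fun a ha => Finset.mem_Iio.2 (hm (Finset.mem_Iio.1 ha))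
    · exact Finset.image_subset_iff.2 fun a ha => Finset.mem_Ioi.2 (hm (Finset.mem_Ioi.1 ha))
  · intro e he e' he' h
    obtain ⟨he, hk⟩ := Finset.mem_filter.1 he
    obtain ⟨he', hk'⟩ := Finset.mem_filter.1 he'
    refine ((strictMono_of_mem he).range_inj (strictMono_of_mem he')).1 ?_
    obtain ⟨h1, h2⟩ := Prod.ext_iff.1 h
    have hr : ∀ f : Fin m → Fin n, Finset.univ.image f =
        insert (f k) ((Finset.Iio k).image f ∪ (Finset.Ioi k).image f) := by
      intro f
      rw [← Finset.image_union, ← Finset.image_insert]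
      congr 1
      ext a
      rcases lt_trichotomy a k with h | h | h <;> simp [h]
    have := (hr e).trans ((by rw [hk, hk']; simp only at h1 h2; rw [h1, h2]) : _ = _)
      |>.trans (hr e').symm
    have := congrArg (fun s : Finset (Fin n) => (s : Set (Fin n))) this
    simpa using this
  · rintro ⟨A, B⟩ hAB
    obtain ⟨hA, hB⟩ := Finset.mem_product.1 hAB
    obtain ⟨hA, hAc⟩ := Finset.mem_powersetCard.1 hA
    obtain ⟨hB, hBc⟩ := Finset.mem_powersetCard.1 hB
    simp only at hA hAc hB hBc
    have hA' : ∀ x ∈ A, x < i := fun x hx => Finset.mem_Iio.1 (hA hx)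
    have hB' : ∀ x ∈ B, i < x := fun x hx => Finset.mem_Ioi.1 (hB hx)
    have hdisj : Disjoint A B := Finset.disjoint_left.2 fun x hx hy =>
      lt_asymm (hA' x hx) (hB' x hy)
    have hi : i ∉ A ∪ B := by
      rw [Finset.mem_union]
      rintro (h | h)
      · exact lt_irrefl _ (hA' i h)
      · exact lt_irrefl _ (hB' i h)
    set s := insert i (A ∪ B) with hs
    have hc : s.card = m := by
      rw [hs, Finset.card_insert_of_notMem hi, Finset.card_union_of_disjoint hdisj, hAc, hBc]
      have := k.isLt
      omega
    have hsA : s.filter (· < i) = A := by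
      ext x
      simp only [hs, Finset.mem_filter, Finset.mem_insert, Finset.mem_union]
      constructor
      · rintro ⟨rfl | h | h, hx⟩
        · exact absurd hx (lt_irrefl _)
        · exact h
        · exact absurd hx (lt_asymm (hB' x h))
      · exact fun h => ⟨Or.inr (Or.inl h), hA' x h⟩
    have hsB : s.filter (i < ·) = B := by
      ext x
      simp only [hs, Finset.mem_filter, Finset.mem_insert, Finset.mem_union]
      constructor
      · rintro ⟨rfl | h | h, hx⟩
        · exact absurd hx (lt_irrefl _)
        · exact absurd hx (lt_asymm (hA' x h))
        · exact h
      · exact fun h => ⟨Or.inr (Or.inr h), hB' x h⟩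
    have hm := (s.orderEmbOfFin hc).strictMono
    have him := s.image_orderEmbOfFin_univ hc
    obtain ⟨k', hk'⟩ : ∃ k', s.orderEmbOfFin hc k' = i := by
      have : i ∈ Finset.univ.image (s.orderEmbOfFin hc) := by rw [him, hs]; simp
      exact (Finset.mem_image.1 this).imp fun _ h => h.2
    have eA := image_Iio_of_strictMono hm k'
    have eB := image_Ioi_of_strictMono hm k'
    rw [him, hk'] at eA eB
    rw [hsA] at eA
    rw [hsB] at eB
    have hkk : k' = k := by
      have := congrArg Finset.card eA
      rw [hAc, Finset.card_image_of_injective _ hm.injective, Fin.card_Iio] at this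
      exact Fin.ext this.symm
    subst hkk
    exact ⟨s.orderEmbOfFin hc, Finset.mem_filter.2 ⟨mem_increasingSeqs.2 hm, hk'⟩,
      Prod.ext eA.symm eB.symm⟩

theorem card_eq_mul (k : Fin m) (i : Fin n) :
    (Finset.univ.filter fun e : Fin m → Fin n => e k = i).card * n = n ^ m := by
  have h : (Finset.univ.filter fun e : Fin m → Fin n => e k = i) =
      Fintype.piFinset fun a => if a = k then {i} else Finset.univ := by
    ext e
    simp only [Finset.mem_filter, Finset.mem_univ, true_and, Fintype.mem_piFinset]
    constructor
    · rintro rfl a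
      split_ifs with h <;> simp [h]
    · intro h
      simpa using h k
  rw [h, Fintype.card_piFinset, ← Finset.mul_prod_erase _ _ (Finset.mem_univ k)]
  have : ∀ a ∈ Finset.univ.erase k,
      (if a = k then ({i} : Finset (Fin n)) else Finset.univ).card = n := by
    intro a ha
    rw [if_neg (Finset.ne_of_mem_erase ha)]; simp
  rw [Finset.prod_congr rfl this]
  obtain ⟨m, rfl⟩ : ∃ m', m = m' + 1 := ⟨m - 1, by have := k.isLt; omega⟩
  simp [pow_succ]

theorem card_eq_eq_mul {k l : Fin m} (hkl : k ≠ l) (i j : Fin n) :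
    (Finset.univ.filter fun e : Fin m → Fin n => e k = i ∧ e l = j).card * n ^ 2 = n ^ m := by
  have h : (Finset.univ.filter fun e : Fin m → Fin n => e k = i ∧ e l = j) =
      Fintype.piFinset fun a => if a = k then {i} else if a = l then {j} else Finset.univ := by
    ext e
    simp only [Finset.mem_filter, Finset.mem_univ, true_and, Fintype.mem_piFinset]
    constructor
    · rintro ⟨rfl, rfl⟩ a
      split_ifs with h1 h2 <;> simp [*]
    · intro h
      exact ⟨by simpa using h k, by simpa [hkl.symm] using h l⟩
  have hl : l ∈ Finset.univ.erase k := Finset.mem_erase.2 ⟨hkl.symm, Finset.mem_univ _⟩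
  rw [h, Fintype.card_piFinset, ← Finset.mul_prod_erase _ _ (Finset.mem_univ k),
    ← Finset.mul_prod_erase _ _ hl]
  have : ∀ a ∈ (Finset.univ.erase k).erase l,
      (if a = k then ({i} : Finset (Fin n)) else if a = l then {j} else Finset.univ).card = n := by
    intro a ha
    rw [if_neg (Finset.ne_of_mem_erase (Finset.mem_of_mem_erase ha)),
      if_neg (Finset.ne_of_mem_erase ha)]; simp
  rw [Finset.prod_congr rfl this]
  obtain ⟨m, rfl⟩ : ∃ m', m = m' + 2 := ⟨m - 2, by
    have := k.isLt; have := l.isLt; have := Fin.val_ne_of_ne hkl; omega⟩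
  rw [Finset.prod_const, Finset.card_erase_of_mem hl, Finset.card_erase_of_mem (Finset.mem_univ _)]
  simp [hkl.symm, pow_add]

end Counting

/-! ### First and second differences of `U`-statistics -/

section UStatistic

variable {m n : ℕ}

/-- The asymmetric `U`-statistic of the coordinates of a point of the cube with kernel `G`. -/
noncomputable def uStat (G : (Fin m → Bool) → ℝ) (n : ℕ) (ξ : Fin n → Bool) : ℝ :=
  ∑ e ∈ increasingSeqs m n, G (ξ ∘ e)

theorem cubeAvg_uStat (G : (Fin m → Bool) → ℝ) (n : ℕ) :
    cubeAvg (uStat G n) = n.choose m * cubeAvg G := by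
  unfold uStat
  rw [cubeAvg_sum, Finset.sum_congr rfl fun e he =>
    cubeAvg_comp_injective (strictMono_of_mem he).injective G]
  simp [card_increasingSeqs]

theorem cubeDeriv_comp {e : Fin m → Fin n} (he : Function.Injective e)
    (G : (Fin m → Bool) → ℝ) (i : Fin n) (ξ : Fin n → Bool) :
    cubeDeriv i (fun ξ => G (ξ ∘ e)) ξ =
      ∑ k, if e k = i then cubeDeriv k G (ξ ∘ e) else 0 := by
  by_cases h : ∃ k, e k = i
  · obtain ⟨k, rfl⟩ := h
    rw [Finset.sum_eq_single k]
    · simp only [cubeDeriv, Function.update_comp_eq_of_injective _ he, if_true]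
    · intro l _ hl
      rw [if_neg (he.ne hl)]
    · simp
  · push Not at h
    have hu : ∀ b, Function.update ξ i b ∘ e = ξ ∘ e := by
      intro b; funext k; simp [Function.update_of_ne (h k)]
    simp [cubeDeriv, hu, h]

theorem cubeDeriv_uStat (G : (Fin m → Bool) → ℝ) (i : Fin n) (ξ : Fin n → Bool) :
    cubeDeriv i (uStat G n) ξ = ∑ e ∈ increasingSeqs m n,
      ∑ k, if e k = i then cubeDeriv k G (ξ ∘ e) else 0 := by
  unfold uStat
  rw [cubeDeriv_sum]
  exact Finset.sum_congr rfl fun e he => cubeDeriv_comp (strictMono_of_mem he).injective _ _ _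

theorem cubeDeriv_cubeDeriv_self (k : Fin m) (G : (Fin m → Bool) → ℝ) (ζ : Fin m → Bool) :
    cubeDeriv k (cubeDeriv k G) ζ = 0 := by
  simp [cubeDeriv]

theorem abs_cubeDeriv_le {G : (Fin m → Bool) → ℝ} {c : ℝ} (hG : ∀ ζ, |G ζ| ≤ c) (k : Fin m)
    (ζ : Fin m → Bool) : |cubeDeriv k G ζ| ≤ c := by
  have h1 := abs_le.1 (hG (Function.update ζ k true))
  have h2 := abs_le.1 (hG (Function.update ζ k false))
  rw [cubeDeriv, abs_le]
  constructor <;> linarith [h1.1, h1.2, h2.1, h2.2]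

theorem cubeDeriv_cubeDeriv_uStat (G : (Fin m → Bool) → ℝ) (i j : Fin n) (ξ : Fin n → Bool) :
    cubeDeriv j (cubeDeriv i (uStat G n)) ξ = ∑ k, ∑ l, ∑ e ∈ increasingSeqs m n,
      if e k = i ∧ e l = j then cubeDeriv l (cubeDeriv k G) (ξ ∘ e) else 0 := by
  have h : cubeDeriv i (uStat G n) = fun ξ => ∑ e ∈ increasingSeqs m n,
      ∑ k, (if e k = i then 1 else 0) * cubeDeriv k G (ξ ∘ e) := by
    funext ξ; rw [cubeDeriv_uStat]; simp
  rw [h, cubeDeriv_sum]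
  have h2 : ∀ e ∈ increasingSeqs m n,
      cubeDeriv j (fun ξ => ∑ k, (if e k = i then 1 else 0) * cubeDeriv k G (ξ ∘ e)) ξ =
      ∑ k, ∑ l, if e k = i ∧ e l = j then cubeDeriv l (cubeDeriv k G) (ξ ∘ e) else 0 := by
    intro e he
    rw [cubeDeriv_sum]
    refine Finset.sum_congr rfl fun k _ => ?_
    rw [cubeDeriv_const_mul, cubeDeriv_comp (strictMono_of_mem he).injective, Finset.mul_sum]
    refine Finset.sum_congr rfl fun l _ => ?_
    by_cases h1 : e k = i <;> by_cases h2 : e l = j <;> simp [h1, h2]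
  rw [Finset.sum_congr rfl h2, Finset.sum_comm]
  exact Finset.sum_congr rfl fun k _ => Finset.sum_comm

/-- At most n^(m-1) sequences take the value `i` at a given place, and each contributes at most 1.
The form `n ^ m / n` avoids truncated subtraction in the exponent. -/
theorem abs_cubeDeriv_uStat_le {G : (Fin m → Bool) → ℝ} (hG : ∀ ζ, |G ζ| ≤ 1) (i : Fin n)
    (ξ : Fin n → Bool) : |cubeDeriv i (uStat G n) ξ| ≤ m * ((n : ℝ) ^ m / n) := by
  have hn : (0 : ℝ) < n := Nat.cast_pos.2 (Fin.pos i)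
  rw [cubeDeriv_uStat, Finset.sum_comm]
  refine (Finset.abs_sum_le_sum_abs _ _).trans ?_
  have h : ∀ k ∈ (Finset.univ : Finset (Fin m)), |∑ e ∈ increasingSeqs m n,
      if e k = i then cubeDeriv k G (ξ ∘ e) else 0| ≤ (n : ℝ) ^ m / n := by
    intro k _
    rw [← Finset.sum_filter]
    refine (Finset.abs_sum_le_sum_abs _ _).trans ?_
    refine (Finset.sum_le_card_nsmul _ _ 1 fun e _ => abs_cubeDeriv_le hG k _).trans ?_
    rw [nsmul_one, le_div_iff₀ hn]
    have := card_eq_mul k i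
    have h2 := Finset.card_le_card (Finset.filter_subset_filter (fun e : Fin m → Fin n => e k = i)
      (Finset.subset_univ (increasingSeqs m n)))
    exact_mod_cast (Nat.mul_le_mul_right n h2).trans this.le
  refine (Finset.sum_le_card_nsmul _ _ _ h).trans ?_
  simp

/-- Two distinct places are pinned, leaving at most n^(m-2) sequences; equal places contribute
nothing, since a difference in one direction no longer depends on that coordinate. -/
theorem abs_cubeDeriv_cubeDeriv_uStat_le {G : (Fin m → Bool) → ℝ} (hG : ∀ ζ, |G ζ| ≤ 1)
    (i j : Fin n) (ξ : Fin n → Bool) :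
    |cubeDeriv j (cubeDeriv i (uStat G n)) ξ| ≤ m * (m * ((n : ℝ) ^ m / n ^ 2)) := by
  have hn : (0 : ℝ) < n := Nat.cast_pos.2 (Fin.pos i)
  rw [cubeDeriv_cubeDeriv_uStat]
  have h : ∀ k l : Fin m, |∑ e ∈ increasingSeqs m n,
      if e k = i ∧ e l = j then cubeDeriv l (cubeDeriv k G) (ξ ∘ e) else 0| ≤
        (n : ℝ) ^ m / n ^ 2 := by
    intro k l
    rcases eq_or_ne k l with rfl | hkl
    · simp only [cubeDeriv_cubeDeriv_self, ite_self, Finset.sum_const_zero, abs_zero]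
      positivity
    rw [← Finset.sum_filter]
    refine (Finset.abs_sum_le_sum_abs _ _).trans ?_
    refine (Finset.sum_le_card_nsmul _ _ 1
      fun e _ => abs_cubeDeriv_le (abs_cubeDeriv_le hG k) l _).trans ?_
    rw [nsmul_one, le_div_iff₀ (by positivity)]
    have := card_eq_eq_mul hkl i j
    have h2 := Finset.card_le_card (Finset.filter_subset_filter
      (fun e : Fin m → Fin n => e k = i ∧ e l = j) (Finset.subset_univ (increasingSeqs m n)))
    exact_mod_cast (Nat.mul_le_mul_right (n ^ 2) h2).trans this.le
  refine (Finset.abs_sum_le_sum_abs _ _).trans ((Finset.sum_le_card_nsmul _ _ _ fun k _ =>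
    (Finset.abs_sum_le_sum_abs _ _).trans (Finset.sum_le_card_nsmul _ _ _ fun l _ =>
      h k l)).trans ?_)
  simp

/-- The coefficients of the linear approximation of a `U`-statistic. -/
theorem cubeAvg_cubeDeriv_uStat (G : (Fin m → Bool) → ℝ) (i : Fin n) :
    cubeAvg (cubeDeriv i (uStat G n)) = ∑ k : Fin m,
      cubeAvg (cubeDeriv k G) * ((i : ℕ).choose k * (n - 1 - i).choose (m - 1 - k) : ℕ) := by
  have h : cubeDeriv i (uStat G n) = fun ξ => ∑ e ∈ increasingSeqs m n,
      ∑ k, (if e k = i then 1 else 0) * cubeDeriv k G (ξ ∘ e) := by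
    funext ξ; rw [cubeDeriv_uStat]; simp
  rw [h, cubeAvg_sum]
  have h2 : ∀ e ∈ increasingSeqs m n,
      cubeAvg (fun ξ => ∑ k, (if e k = i then 1 else 0) * cubeDeriv k G (ξ ∘ e)) =
      ∑ k, if e k = i then cubeAvg (cubeDeriv k G) else 0 := by
    intro e he
    rw [cubeAvg_sum]
    refine Finset.sum_congr rfl fun k _ => ?_
    rw [cubeAvg_const_mul, cubeAvg_comp_injective (strictMono_of_mem he).injective]
    simp
  rw [Finset.sum_congr rfl h2, Finset.sum_comm]
  refine Finset.sum_congr rfl fun k _ => ?_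
  rw [← Finset.sum_filter, Finset.sum_const, card_increasingSeqs_eq, nsmul_eq_mul, mul_comm]

theorem cubeAvg_sq_uStat_sub_linear_le {G : (Fin m → Bool) → ℝ} (hG : ∀ ζ, |G ζ| ≤ 1) (n : ℕ) :
    cubeAvg (fun ξ => (uStat G n ξ - cubeAvg (uStat G n) -
      ∑ i, cubeAvg (cubeDeriv i (uStat G n)) * sgn (ξ i)) ^ 2) ≤
      n * (n * (m * (m * ((n : ℝ) ^ m / n ^ 2))) ^ 2) := by
  refine (cubeAvg_sq_sub_linear_le _).trans ?_
  refine (Finset.sum_le_card_nsmul _ _ _ fun i _ => Finset.sum_le_card_nsmul _ _ _ fun j _ =>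
    (cubeAvg_mono fun ξ => ?_).trans_eq
      (cubeAvg_const ((m * (m * ((n : ℝ) ^ m / n ^ 2))) ^ 2))).trans ?_
  · exact sq_le_sq' (by linarith [(abs_le.1 (abs_cubeDeriv_cubeDeriv_uStat_le hG i j ξ)).1])
      (abs_le.1 (abs_cubeDeriv_cubeDeriv_uStat_le hG i j ξ)).2
  · simp

end UStatistic

/-! ### Binomial asymptotics and Riemann sums -/

section Limits

theorem tendsto_descFactorial_div_pow {N : ℕ → ℕ} {x : ℝ}
    (hN : Tendsto (fun n => (N n : ℝ) / n) atTop (𝓝 x)) (k : ℕ) :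
    Tendsto (fun n => ((N n).descFactorial k : ℝ) / (n : ℝ) ^ k) atTop (𝓝 (x ^ k)) := by
  induction k with
  | zero => simp
  | succ k ih =>
    -- The natural subtraction may truncate, so the quotient is squeezed between (N n - k)/n and N
    -- n/n.
    have h : Tendsto (fun n => ((N n - k : ℕ) : ℝ) / n) atTop (𝓝 x) := by
      have hk : Tendsto (fun n : ℕ => (N n : ℝ) / n - (k : ℝ) / n) atTop (𝓝 x) := by
        simpa using hN.sub (tendsto_const_div_atTop_nhds_zero_nat (k : ℝ))
      refine tendsto_of_tendsto_of_tendsto_of_le_of_le hk hN (fun n => ?_) (fun n => ?_)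
      · simp only [← sub_div]
        refine div_le_div_of_nonneg_right ?_ (Nat.cast_nonneg n)
        rw [sub_le_iff_le_add]
        have : N n ≤ N n - k + k := by omega
        exact_mod_cast this
      · refine div_le_div_of_nonneg_right ?_ (Nat.cast_nonneg n)
        exact Nat.cast_le.2 (Nat.sub_le _ _)
    refine (h.mul ih).congr' (Eventually.of_forall fun n => ?_) |>.trans ?_
    · rw [Nat.descFactorial_succ, pow_succ', Nat.cast_mul, div_mul_div_comm]
    · rw [pow_succ']

theorem tendsto_choose_div_pow {N : ℕ → ℕ} {x : ℝ}
    (hN : Tendsto (fun n => (N n : ℝ) / n) atTop (𝓝 x)) (k : ℕ) :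
    Tendsto (fun n => ((N n).choose k : ℝ) / (n : ℝ) ^ k) atTop (𝓝 (x ^ k / k !)) := by
  refine ((tendsto_descFactorial_div_pow hN k).div_const (k ! : ℝ)).congr fun n => ?_
  rw [Nat.descFactorial_eq_factorial_mul_choose, Nat.cast_mul]
  have : (k ! : ℝ) ≠ 0 := by positivity
  field_simp

/-- The index i = ⌈nx⌉ - 1 labels the cell (i/n, (i+1)/n] containing `x`; it turns sums over `i`
into integrals of step functions. -/
theorem tendsto_ceil_sub_one_div {x : ℝ} (hx : 0 < x) :
    Tendsto (fun n : ℕ => ((⌈(n : ℝ) * x⌉₊ - 1 : ℕ) : ℝ) / n) atTop (𝓝 x) := by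
  have h1 : Tendsto (fun n : ℕ => (⌈(n : ℝ) * x⌉₊ : ℝ) / n) atTop (𝓝 x) := by
    simpa [Function.comp_def, mul_comm] using
      (tendsto_nat_ceil_mul_div_atTop (R := ℝ) hx.le).comp tendsto_natCast_atTop_atTop
  have h2 := h1.sub (tendsto_const_div_atTop_nhds_zero_nat (1 : ℝ))
  rw [sub_zero] at h2
  refine h2.congr' ?_
  filter_upwards [eventually_ge_atTop 1] with n hn
  have : 1 ≤ ⌈(n : ℝ) * x⌉₊ := Nat.one_le_ceil_iff.2 (by positivity)
  rw [Nat.cast_sub this, sub_div, Nat.cast_one]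

theorem tendsto_sub_ceil_div {x : ℝ} (hx : 0 < x) (hx1 : x ≤ 1) :
    Tendsto (fun n : ℕ => ((n - 1 - (⌈(n : ℝ) * x⌉₊ - 1) : ℕ) : ℝ) / n) atTop (𝓝 (1 - x)) := by
  have h2 := (tendsto_const_nhds (x := (1 : ℝ))).sub
    ((tendsto_ceil_sub_one_div hx).add (tendsto_const_div_atTop_nhds_zero_nat (1 : ℝ)))
  rw [add_zero] at h2
  refine h2.congr' ?_
  filter_upwards [eventually_ge_atTop 1] with n hn
  have h1 : 1 ≤ ⌈(n : ℝ) * x⌉₊ := Nat.one_le_ceil_iff.2 (by positivity)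
  have h3 : ⌈(n : ℝ) * x⌉₊ ≤ n := Nat.ceil_le.2 (by nlinarith [(Nat.cast_nonneg n : (0 : ℝ) ≤ n)])
  have hn' : (n : ℝ) ≠ 0 := by positivity
  rw [show n - 1 - (⌈(n : ℝ) * x⌉₊ - 1) = n - ⌈(n : ℝ) * x⌉₊ by omega, Nat.cast_sub h1,
    Nat.cast_sub h3]
  field_simp
  push_cast
  ring

theorem measurable_comp_ceil (g : ℕ → ℝ) (n : ℕ) :
    Measurable fun x : ℝ => g (⌈(n : ℝ) * x⌉₊ - 1) :=
  (measurable_of_countable fun k : ℕ => g (k - 1)).comp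
    (Nat.measurable_ceil.comp (measurable_const_mul (n : ℝ)))

theorem integral_comp_ceil (g : ℕ → ℝ) {n : ℕ} (hn : 0 < n) :
    ∫ x in (0 : ℝ)..1, g (⌈(n : ℝ) * x⌉₊ - 1) = (∑ i ∈ Finset.range n, g i) / n := by
  have hn' : (0 : ℝ) < n := Nat.cast_pos.2 hn
  have hc : ∀ i : ℕ, Set.EqOn (fun x : ℝ => g (⌈(n : ℝ) * x⌉₊ - 1)) (fun _ => g i)
      (Set.uIoc ((i : ℝ) / n) (((i + 1 : ℕ) : ℝ) / n)) := by
    intro i x hx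
    rw [Set.uIoc_of_le (by gcongr; simp), Set.mem_Ioc, div_lt_iff₀ hn', le_div_iff₀ hn'] at hx
    have : ⌈(n : ℝ) * x⌉₊ = i + 1 := by
      rw [Nat.ceil_eq_iff (by simp)]
      constructor
      · simpa [mul_comm] using hx.1
      · simpa [mul_comm] using hx.2
    simp [this]
  have hint : ∀ i < n, IntervalIntegrable (fun x : ℝ => g (⌈(n : ℝ) * x⌉₊ - 1)) volume
      ((i : ℝ) / n) (((i + 1 : ℕ) : ℝ) / n) := fun i _ =>
    (intervalIntegrable_congr (hc i)).2 intervalIntegrable_const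
  have h := intervalIntegral.sum_integral_adjacent_intervals (μ := volume)
    (f := fun x : ℝ => g (⌈(n : ℝ) * x⌉₊ - 1)) (a := fun i : ℕ => (i : ℝ) / n) hint
  rw [Nat.cast_zero, zero_div, div_self hn'.ne'] at h
  rw [← h, Finset.sum_div]
  refine Finset.sum_congr rfl fun i _ => ?_
  rw [intervalIntegral.integral_congr_ae (g := fun _ => g i)
    (Eventually.of_forall fun x hx => hc i hx), intervalIntegral.integral_const, smul_eq_mul]
  push_cast
  field_simp
  ring

end Limits

/-! ### Linear coefficients and the limiting variance -/

section Coefficients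

variable {m : ℕ}

/-- The coefficients of the linear approximation of a `U`-statistic, where `c` holds the
coefficients of the linear part of its kernel. -/
noncomputable def linCoeff (c : Fin m → ℝ) (n i : ℕ) : ℝ :=
  ∑ k : Fin m, c k * ((i.choose k * (n - 1 - i).choose (m - 1 - k) : ℕ) : ℝ)

/-- The scaling limit of `linCoeff`. -/
noncomputable def limCoeff (c : Fin m → ℝ) (x : ℝ) : ℝ :=
  ∑ k : Fin m, c k * (x ^ (k : ℕ) / (k : ℕ)! * ((1 - x) ^ (m - 1 - k) / (m - 1 - k)!))

theorem continuous_limCoeff (c : Fin m → ℝ) : Continuous (limCoeff c) := by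
  unfold limCoeff; fun_prop

theorem abs_linCoeff_div_le (c : Fin m → ℝ) {n i : ℕ} (hi : i < n) :
    |linCoeff c n i / (n : ℝ) ^ (m - 1)| ≤ ∑ k, |c k| := by
  have hn : (0 : ℝ) < n := Nat.cast_pos.2 (by omega)
  rw [abs_div, abs_of_nonneg (by positivity : (0 : ℝ) ≤ (n : ℝ) ^ (m - 1)),
    div_le_iff₀ (by positivity), linCoeff, Finset.sum_mul]
  refine (Finset.abs_sum_le_sum_abs _ _).trans (Finset.sum_le_sum fun k _ => ?_)
  rw [abs_mul, Nat.abs_cast]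
  refine mul_le_mul_of_nonneg_left ?_ (abs_nonneg _)
  have h1 : i.choose k ≤ n ^ (k : ℕ) :=
    (Nat.choose_le_pow i k).trans (Nat.pow_le_pow_left hi.le _)
  have h2 : (n - 1 - i).choose (m - 1 - k) ≤ n ^ (m - 1 - k) :=
    (Nat.choose_le_pow _ _).trans (Nat.pow_le_pow_left (by omega) _)
  have h3 : n ^ (k : ℕ) * n ^ (m - 1 - k) = n ^ (m - 1) := by
    rw [← pow_add]; congr 1; have := k.isLt; omega
  exact_mod_cast (Nat.mul_le_mul h1 h2).trans h3.le

theorem tendsto_linCoeff (c : Fin m → ℝ) {x : ℝ} (hx : 0 < x) (hx1 : x ≤ 1) :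
    Tendsto (fun n : ℕ => linCoeff c n (⌈(n : ℝ) * x⌉₊ - 1) / (n : ℝ) ^ (m - 1)) atTop
      (𝓝 (limCoeff c x)) := by
  have h : ∀ n : ℕ, linCoeff c n (⌈(n : ℝ) * x⌉₊ - 1) / (n : ℝ) ^ (m - 1) =
      ∑ k : Fin m, c k * (((⌈(n : ℝ) * x⌉₊ - 1).choose k : ℝ) / (n : ℝ) ^ (k : ℕ) *
        (((n - 1 - (⌈(n : ℝ) * x⌉₊ - 1)).choose (m - 1 - k) : ℝ) / (n : ℝ) ^ (m - 1 - k))) := by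
    intro n
    rw [linCoeff, Finset.sum_div]
    refine Finset.sum_congr rfl fun k _ => ?_
    have h3 : (n : ℝ) ^ (m - 1) = (n : ℝ) ^ (k : ℕ) * (n : ℝ) ^ (m - 1 - k) := by
      rw [← pow_add]; congr 1; have := k.isLt; omega
    rw [h3, div_mul_div_comm, Nat.cast_mul, mul_div_assoc]
  simp only [h]
  exact tendsto_finsetSum _ fun k _ => ((tendsto_choose_div_pow (tendsto_ceil_sub_one_div hx) _).mul
    (tendsto_choose_div_pow (tendsto_sub_ceil_div hx hx1) _)).const_mul _

/-- The summand changes with n, so the sum is rewritten as the integral of a step function and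
dominated convergence is applied, with a constant as dominating function. -/
theorem tendsto_sum_sq_linCoeff (c : Fin m → ℝ) :
    Tendsto (fun n : ℕ => (∑ i : Fin n, (linCoeff c n i / (n : ℝ) ^ (m - 1)) ^ 2) / n) atTop
      (𝓝 (∫ x in (0 : ℝ)..1, limCoeff c x ^ 2)) := by
  have h : Tendsto (fun n : ℕ => ∫ x in (0 : ℝ)..1,
      (linCoeff c n (⌈(n : ℝ) * x⌉₊ - 1) / (n : ℝ) ^ (m - 1)) ^ 2) atTop
      (𝓝 (∫ x in (0 : ℝ)..1, limCoeff c x ^ 2)) := by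
    refine intervalIntegral.tendsto_integral_filter_of_dominated_convergence
      (fun _ => (∑ k, |c k|) ^ 2) ?_ ?_ intervalIntegrable_const ?_
    · exact Eventually.of_forall fun n => (measurable_comp_ceil
        (fun i => (linCoeff c n i / (n : ℝ) ^ (m - 1)) ^ 2) n).aestronglyMeasurable
    · filter_upwards [eventually_ge_atTop 1] with n hn
      refine Eventually.of_forall fun x hx => ?_
      rw [Set.uIoc_of_le zero_le_one] at hx
      have h3 : ⌈(n : ℝ) * x⌉₊ ≤ n :=
        Nat.ceil_le.2 (by nlinarith [(Nat.cast_nonneg n : (0 : ℝ) ≤ n), hx.2])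
      rw [norm_pow, Real.norm_eq_abs]
      exact pow_le_pow_left₀ (abs_nonneg _) (abs_linCoeff_div_le c (by omega)) 2
    · refine Eventually.of_forall fun x hx => ?_
      rw [Set.uIoc_of_le zero_le_one] at hx
      exact (tendsto_linCoeff c hx.1 hx.2).pow 2
  refine h.congr' ?_
  filter_upwards [eventually_gt_atTop 0] with n hn
  rw [integral_comp_ceil (fun i => (linCoeff c n i / (n : ℝ) ^ (m - 1)) ^ 2) hn,
    ← Fin.sum_univ_eq_sum_range (fun i => (linCoeff c n i / (n : ℝ) ^ (m - 1)) ^ 2)]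

/-- Euler's Beta integral, transferred from its complex version. -/
theorem integral_pow_mul_one_sub_pow (a b : ℕ) :
    ∫ x in (0 : ℝ)..1, x ^ a * (1 - x) ^ b = (a ! * b ! : ℝ) / (a + b + 1)! := by
  have h := Complex.betaIntegral_eq_Gamma_mul_div (a + 1) (b + 1)
    (by simp; positivity) (by simp; positivity)
  rw [Complex.Gamma_nat_eq_factorial, Complex.Gamma_nat_eq_factorial,
    show (a + 1 + (b + 1) : ℂ) = ((a + b + 1 : ℕ) : ℂ) + 1 by push_cast; ring,
    Complex.Gamma_nat_eq_factorial, Complex.betaIntegral] at h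
  simp only [add_sub_cancel_right, Complex.cpow_natCast] at h
  have h2 : ∫ x in (0 : ℝ)..1, ((x : ℂ) ^ a * (1 - (x : ℂ)) ^ b) =
      ((∫ x in (0 : ℝ)..1, x ^ a * (1 - x) ^ b : ℝ) : ℂ) := by
    rw [← intervalIntegral.integral_ofReal]; push_cast; rfl
  rw [h2] at h
  exact Complex.ofReal_injective (h.trans (by push_cast; rfl))

theorem integral_sq_limCoeff (c : Fin m → ℝ) :
    ∫ x in (0 : ℝ)..1, limCoeff c x ^ 2 = ∑ i : Fin m, ∑ j : Fin m,
      ((((i : ℕ) + j)! : ℝ) * ((2 * m - 2 - i - j)! : ℝ)) /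
          (((i : ℕ)! : ℝ) * ((j : ℕ)! : ℝ) * ((m - 1 - i)! : ℝ) * ((m - 1 - j)! : ℝ) *
            ((2 * m - 1)! : ℝ)) * c i * c j := by
  have h : ∀ x, limCoeff c x ^ 2 = ∑ i : Fin m, ∑ j : Fin m,
      c i * c j / ((i : ℕ)! * (j : ℕ)! * (m - 1 - i)! * (m - 1 - j)!) *
        (x ^ ((i : ℕ) + j) * (1 - x) ^ (2 * m - 2 - i - j)) := by
    intro x
    rw [sq, limCoeff, Finset.sum_mul_sum]
    refine Finset.sum_congr rfl fun i _ => Finset.sum_congr rfl fun j _ => ?_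
    rw [show 2 * m - 2 - i - j = (m - 1 - i) + (m - 1 - j) by omega, pow_add, pow_add]
    field_simp
  simp only [h]
  rw [intervalIntegral.integral_finsetSum]
  · refine Finset.sum_congr rfl fun i _ => ?_
    rw [intervalIntegral.integral_finsetSum]
    · refine Finset.sum_congr rfl fun j _ => ?_
      rw [intervalIntegral.integral_const_mul, integral_pow_mul_one_sub_pow,
        show (i : ℕ) + j + (2 * m - 2 - i - j) + 1 = 2 * m - 1 by
          have := i.isLt; have := j.isLt; omega]
      field_simp
    · intro j _
      exact (by fun_prop : Continuous _).intervalIntegrable _ _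
  · intro i _
    exact (by fun_prop : Continuous _).intervalIntegrable _ _

/-- Near 0, `limCoeff c x` is `x` times a continuous `q` with `q 0 = c 1 / (m - 2)!`, which is
nonzero; hence the continuous square cannot vanish throughout [0, 1]. -/
theorem integral_sq_limCoeff_pos (c : Fin m → ℝ) (hm : 2 ≤ m) (h0 : c ⟨0, by omega⟩ = 0)
    (h1 : c ⟨1, by omega⟩ ≠ 0) : 0 < ∫ x in (0 : ℝ)..1, limCoeff c x ^ 2 := by
  have hex : ∃ x ∈ Set.Icc (0 : ℝ) 1, limCoeff c x ≠ 0 := by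
    by_contra! hcon
    obtain ⟨m, rfl⟩ : ∃ m', m = m' + 2 := ⟨m - 2, by omega⟩
    set q : ℝ → ℝ := fun x => ∑ k : Fin (m + 1),
      c k.succ * (x ^ (k : ℕ) / (k + 1 : ℕ)! * ((1 - x) ^ (m - k) / (m - k)!)) with hq
    have hpq : ∀ x, limCoeff c x = x * q x := by
      intro x
      rw [limCoeff, Fin.sum_univ_succ]
      have h0' : c 0 = 0 := h0
      rw [h0', zero_mul, zero_add, hq, Finset.mul_sum]
      refine Finset.sum_congr rfl fun k _ => ?_
      rw [Fin.val_succ, show m + 2 - 1 - ((k : ℕ) + 1) = m - k by omega, pow_succ]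
      ring
    have hqc : Continuous q := by simp only [hq]; fun_prop
    have hq0 : q 0 ≠ 0 := by
      simp only [hq]
      rw [Fin.sum_univ_succ]
      have h1' : c (Fin.succ 0) ≠ 0 := h1
      simpa using ⟨h1', Nat.factorial_ne_zero m⟩
    have hlim : Tendsto q (𝓝[>] 0) (𝓝 (q 0)) := hqc.continuousAt.tendsto.mono_left inf_le_left
    have hz : q =ᶠ[𝓝[>] 0] fun _ => 0 := by
      filter_upwards [Ioc_mem_nhdsGT (zero_lt_one' ℝ)] with x hx
      have := hcon x ⟨hx.1.le, hx.2⟩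
      rw [hpq] at this
      exact (mul_eq_zero.1 this).resolve_left hx.1.ne'
    exact hq0 (tendsto_nhds_unique hlim ((tendsto_congr' hz).2 tendsto_const_nhds))
  obtain ⟨x, hx, hne⟩ := hex
  exact intervalIntegral.integral_pos zero_lt_one ((continuous_limCoeff c).pow 2).continuousOn
    (fun x _ => sq_nonneg _) ⟨x, hx, by positivity⟩

end Coefficients

/-! ### Central limit theorem for weighted signs -/

section CharacteristicFunctions

/-- Factors are exchanged one at a time, the others having modulus at most 1. -/
theorem abs_prod_sub_prod_le {ι : Type*} (s : Finset ι) (a b : ι → ℝ) (ha : ∀ i, |a i| ≤ 1)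
    (hb : ∀ i, |b i| ≤ 1) : |∏ i ∈ s, a i - ∏ i ∈ s, b i| ≤ ∑ i ∈ s, |a i - b i| := by
  classical
  induction s using Finset.induction_on with
  | empty => simp
  | insert i s hi ih =>
    rw [Finset.prod_insert hi, Finset.prod_insert hi, Finset.sum_insert hi]
    have h1 : |∏ i ∈ s, b i| ≤ 1 := by
      rw [Finset.abs_prod]; exact Finset.prod_le_one (fun _ _ => abs_nonneg _) fun i _ => hb i
    calc |a i * ∏ i ∈ s, a i - b i * ∏ i ∈ s, b i|
        = |a i * (∏ i ∈ s, a i - ∏ i ∈ s, b i) + (a i - b i) * ∏ i ∈ s, b i| := by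
          congr 1; ring
      _ ≤ |a i| * |∏ i ∈ s, a i - ∏ i ∈ s, b i| + |a i - b i| * |∏ i ∈ s, b i| := by
          rw [← abs_mul, ← abs_mul]; exact abs_add_le _ _
      _ ≤ 1 * (∑ i ∈ s, |a i - b i|) + |a i - b i| * 1 := by
          gcongr
          exact ha i
      _ = _ := by ring

/-- Both functions agree with 1 - x²/2 up to a multiple of x⁴, and the two constants add up to less
than 1. -/
theorem abs_cos_sub_exp_le {x : ℝ} (hx : |x| ≤ 1) :
    |Real.cos x - Real.exp (-(x ^ 2 / 2))| ≤ x ^ 4 := by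
  have h1 := abs_le.1 (Real.cos_bound hx)
  have hx2 : x ^ 2 ≤ 1 := (sq_le_one_iff_abs_le_one x).2 hx
  have h2 := abs_le.1 (Real.abs_exp_sub_one_sub_id_le (x := -(x ^ 2 / 2))
    (by rw [abs_neg, abs_of_nonneg (by positivity)]; linarith))
  have h3 : |x| ^ 4 = x ^ 4 := Even.pow_abs ⟨2, rfl⟩ x
  have h4 : 0 ≤ x ^ 4 := by positivity
  have h5 : (-(x ^ 2 / 2)) ^ 2 = x ^ 4 / 4 := by ring
  rw [h3] at h1
  rw [h5] at h2
  rw [abs_le]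
  constructor <;> linarith [h1.1, h1.2, h2.1, h2.2]

theorem cubeAvg_cexp_linear {n : ℕ} (b : Fin n → ℝ) (t : ℝ) :
    cubeAvg (fun ξ => Complex.exp (t * (∑ i, b i * sgn (ξ i) : ℝ) * Complex.I)) =
      ((∏ i, Real.cos (t * b i) : ℝ) : ℂ) := by
  have h : ∀ ξ : Fin n → Bool, Complex.exp (t * (∑ i, b i * sgn (ξ i) : ℝ) * Complex.I) =
      ∏ i, Complex.exp (t * (b i * sgn (ξ i) : ℝ) * Complex.I) := by
    intro ξ
    rw [← Complex.exp_sum, Complex.ofReal_sum, Finset.mul_sum, Finset.sum_mul]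
  simp only [h]
  rw [cubeAvg_prod (fun i c => Complex.exp (t * (b i * sgn c : ℝ) * Complex.I)),
    Complex.ofReal_prod]
  refine Finset.prod_congr rfl fun i _ => ?_
  rw [Complex.ofReal_cos, Complex.cos]
  simp [sgn]

/-- The central limit theorem for weighted sums of independent random signs. -/
theorem tendsto_cubeAvg_cexp_linear (b : ∀ n : ℕ, Fin n → ℝ) {v : ℝ} {δ : ℕ → ℝ}
    (hb : Tendsto (fun n => ∑ i, b n i ^ 2) atTop (𝓝 v)) (hδ : Tendsto δ atTop (𝓝 0))
    (hbδ : ∀ᶠ n in atTop, ∀ i, |b n i| ≤ δ n) (t : ℝ) :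
    Tendsto (fun n => cubeAvg (fun ξ : Fin n → Bool =>
      Complex.exp (t * (∑ i, b n i * sgn (ξ i) : ℝ) * Complex.I))) atTop
      (𝓝 (Real.exp (-(t ^ 2 * v / 2)) : ℝ)) := by
  simp only [cubeAvg_cexp_linear]
  refine (Complex.continuous_ofReal.tendsto _).comp ?_
  have h1 : Tendsto (fun n => Real.exp (-(t ^ 2 * (∑ i, b n i ^ 2) / 2))) atTop
      (𝓝 (Real.exp (-(t ^ 2 * v / 2)))) :=
    (Real.continuous_exp.tendsto _).comp ((hb.const_mul _).div_const _).neg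
  have h2 : Tendsto (fun n => ∏ i, Real.cos (t * b n i) -
      Real.exp (-(t ^ 2 * (∑ i, b n i ^ 2) / 2))) atTop (𝓝 0) := by
    -- Exchanging each cosine for its Gaussian factor costs (t bᵢ)⁴ ≤ t⁴ δ² bᵢ², and the sum of the
    -- bᵢ² stays bounded.
    have h3 : Tendsto (fun n => t ^ 4 * (δ n ^ 2 * ∑ i, b n i ^ 2)) atTop (𝓝 0) := by
      simpa using ((hδ.pow 2).mul hb).const_mul (t ^ 4)
    refine squeeze_zero_norm' ?_ h3
    have hsmall : ∀ᶠ n in atTop, |t| * δ n ≤ 1 := by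
      have : Tendsto (fun n => |t| * δ n) atTop (𝓝 0) := by simpa using hδ.const_mul |t|
      exact (this.eventually (gt_mem_nhds zero_lt_one)).mono fun _ h => h.le
    filter_upwards [hbδ, hsmall] with n hn ht
    have he : Real.exp (-(t ^ 2 * (∑ i, b n i ^ 2) / 2)) =
        ∏ i, Real.exp (-((t * b n i) ^ 2 / 2)) := by
      rw [← Real.exp_sum, Finset.sum_neg_distrib, ← Finset.sum_div, Finset.mul_sum]
      simp only [mul_pow]
    rw [he, Real.norm_eq_abs]
    refine (abs_prod_sub_prod_le _ _ _ (fun i => Real.abs_cos_le_one _) fun i => ?_).trans ?_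
    · rw [abs_of_pos (Real.exp_pos _), Real.exp_le_one_iff, neg_nonpos]; positivity
    rw [Finset.mul_sum, Finset.mul_sum]
    refine Finset.sum_le_sum fun i _ => (abs_cos_sub_exp_le ?_).trans ?_
    · rw [abs_mul]
      exact (mul_le_mul_of_nonneg_left (hn i) (abs_nonneg t)).trans ht
    · have : b n i ^ 2 ≤ δ n ^ 2 := sq_le_sq' (by linarith [(abs_le.1 (hn i)).1]) (abs_le.1 (hn i)).2
      calc (t * b n i) ^ 4 = t ^ 4 * (b n i ^ 2 * b n i ^ 2) := by ring
        _ ≤ _ := by gcongr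
  simpa using h2.add h1

/-- x ↦ exp(itx) is |t|-Lipschitz and the L¹ norm is at most the L² norm. Hence an L² approximation
suffices for characteristic functions. -/
theorem norm_cubeAvg_cexp_sub_le {n : ℕ} (X Y : (Fin n → Bool) → ℝ) (t : ℝ) :
    ‖cubeAvg (fun ξ => Complex.exp (t * (X ξ : ℝ) * Complex.I)) -
      cubeAvg (fun ξ => Complex.exp (t * (Y ξ : ℝ) * Complex.I))‖ ≤
      |t| * Real.sqrt (cubeAvg (fun ξ => (X ξ - Y ξ) ^ 2)) := by
  rw [← cubeAvg_sub]
  refine (norm_cubeAvg_le _).trans ?_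
  have h : ∀ ξ, ‖Complex.exp (t * (X ξ : ℝ) * Complex.I) -
      Complex.exp (t * (Y ξ : ℝ) * Complex.I)‖ ≤ |t| * |X ξ - Y ξ| := by
    intro ξ
    have e : Complex.exp (t * (X ξ : ℝ) * Complex.I) - Complex.exp (t * (Y ξ : ℝ) * Complex.I) =
        Complex.exp ((t * Y ξ : ℝ) * Complex.I) *
          (Complex.exp (Complex.I * (t * (X ξ - Y ξ) : ℝ)) - 1) := by
      rw [mul_sub, ← Complex.exp_add, mul_one]
      push_cast
      congr 2; ring
    rw [e, norm_mul, Complex.norm_exp_ofReal_mul_I, one_mul, ← abs_mul]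
    exact Real.norm_exp_I_mul_ofReal_sub_one_le
  refine (cubeAvg_mono h).trans ?_
  rw [cubeAvg_const_mul]
  refine mul_le_mul_of_nonneg_left (Real.le_sqrt_of_sq_le ?_) (abs_nonneg t)
  refine (sq_cubeAvg_le _).trans_eq ?_
  simp only [sq_abs]

end CharacteristicFunctions

/-! ### From weak convergence to convergence of moments -/

section Moments

/-- Weak convergence and uniformly bounded even moments imply convergence of moments. -/
theorem tendsto_integral_pow {μ : ℕ → ProbabilityMeasure ℝ} {ν : ProbabilityMeasure ℝ}
    (h : Tendsto μ atTop (𝓝 ν)) (hμ : ∀ n k, Integrable (fun x : ℝ => x ^ k) (μ n : Measure ℝ))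
    (hν : ∀ k, Integrable (fun x : ℝ => x ^ k) (ν : Measure ℝ))
    (hC : ∀ k : ℕ, ∃ C, ∀ᶠ n in atTop, ∫ x, x ^ (2 * k) ∂(μ n : Measure ℝ) ≤ C) (k : ℕ) :
    Tendsto (fun n => ∫ x, x ^ k ∂(μ n : Measure ℝ)) atTop (𝓝 (∫ x, x ^ k ∂(ν : Measure ℝ))) := by
  obtain ⟨C₁, hC₁⟩ := hC k
  set C := max 1 (max C₁ (∫ x, x ^ (2 * k) ∂(ν : Measure ℝ))) with hCdef
  have hCpos : 0 < C := lt_of_lt_of_le one_pos (le_max_left _ _)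
  rw [Metric.tendsto_atTop']
  intro ε hε
  -- Clipping y = x^k at height `M` moves it by at most y²/M, so it moves the integral by at most
  -- C/M = ε/4, both along the sequence and in the limit.
  set M := 4 * C / ε with hM
  have hMpos : 0 < M := by positivity
  have hclip : ∀ y : ℝ, |max (-M) (min M y)| ≤ M := fun y =>
    abs_le.2 ⟨le_max_left _ _, max_le (by linarith) (min_le_left _ _)⟩
  have hdiff : ∀ y : ℝ, |y - max (-M) (min M y)| ≤ y ^ 2 / M := by
    intro y
    rw [le_div_iff₀ hMpos]
    rcases le_total M y with h1 | h1
    · rw [min_eq_left h1, max_eq_right (by linarith), abs_of_nonneg (by linarith)]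
      nlinarith
    rw [min_eq_right h1]
    rcases le_total (-M) y with h2 | h2
    · rw [max_eq_right h2]; simp [sq_nonneg]
    · rw [max_eq_left h2, abs_of_nonpos (by linarith)]
      nlinarith
  let g : BoundedContinuousFunction ℝ ℝ := BoundedContinuousFunction.ofNormedAddCommGroup
    (fun x => max (-M) (min M (x ^ k))) (by fun_prop) M fun x => hclip _
  have hg : ∀ x, g x = max (-M) (min M (x ^ k)) := fun x => rfl
  have hbound : ∀ ρ : ProbabilityMeasure ℝ, (∀ k, Integrable (fun x : ℝ => x ^ k) (ρ : Measure ℝ)) →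
      ∫ x, x ^ (2 * k) ∂(ρ : Measure ℝ) ≤ C →
      |∫ x, x ^ k ∂(ρ : Measure ℝ) - ∫ x, g x ∂(ρ : Measure ℝ)| ≤ ε / 4 := by
    intro ρ hρ hρC
    rw [← integral_sub (hρ k) (g.integrable _)]
    calc |∫ x, (x ^ k - g x) ∂(ρ : Measure ℝ)|
        ≤ ∫ x, |x ^ k - g x| ∂(ρ : Measure ℝ) := abs_integral_le_integral_abs
      _ ≤ ∫ x, x ^ (2 * k) / M ∂(ρ : Measure ℝ) := by
          refine integral_mono ((hρ k).sub (g.integrable _)).abs ((hρ _).div_const _) fun x => ?_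
          simp only [hg, mul_comm 2 k, pow_mul]
          exact hdiff _
      _ = (∫ x, x ^ (2 * k) ∂(ρ : Measure ℝ)) / M := integral_div _ _
      _ ≤ C / M := by gcongr
      _ = ε / 4 := by rw [hM]; field_simp
  have hgt := (ProbabilityMeasure.tendsto_iff_forall_integral_tendsto.1 h) g
  rw [Metric.tendsto_nhds] at hgt
  obtain ⟨N, hN⟩ := eventually_atTop.1 ((hgt (ε / 4) (by positivity)).and hC₁)
  refine ⟨N, fun n hn => ?_⟩
  obtain ⟨h1, h2⟩ := hN n hn.le
  have b1 := abs_le.1 (hbound (μ n) (hμ n) (h2.trans ((le_max_left _ _).trans (le_max_right _ _))))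
  have b2 := abs_le.1 (hbound ν hν ((le_max_right _ _).trans (le_max_right _ _)))
  rw [Real.dist_eq] at h1 ⊢
  have b3 := abs_lt.1 h1
  rw [abs_lt]
  constructor <;> linarith [b1.1, b1.2, b2.1, b2.2, b3.1, b3.2]

end Moments

/-! ### Limit of normalized `U`-statistics -/

section UStatisticLimit

variable {m : ℕ}

/-- Each further factor n - k instead of n adds at most k to the constant, and k² + k ≤ (k + 1)². -/
theorem descFactorial_pow_bound (n k : ℕ) :
    (n : ℝ) * ((n : ℝ) ^ k - n.descFactorial k) ≤ (k : ℝ) ^ 2 * (n : ℝ) ^ k := by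
  induction k with
  | zero => simp
  | succ k ih =>
    have h1 : (n : ℝ) - k ≤ ((n - k : ℕ) : ℝ) := by
      rw [sub_le_iff_le_add]
      have : n ≤ n - k + k := by omega
      exact_mod_cast this
    have h2 : (n.descFactorial k : ℝ) ≤ (n : ℝ) ^ k := by exact_mod_cast Nat.descFactorial_le_pow n k
    have h3 : (0 : ℝ) ≤ n.descFactorial k := Nat.cast_nonneg _
    have hn : (0 : ℝ) ≤ n := Nat.cast_nonneg _
    have hk : (0 : ℝ) ≤ k := Nat.cast_nonneg _
    have hp : (0 : ℝ) ≤ (n : ℝ) ^ k := by positivity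
    rw [Nat.descFactorial_succ, Nat.cast_mul, pow_succ]
    have h4 := mul_le_mul_of_nonneg_right h1 h3
    have h5 := mul_le_mul_of_nonneg_left h2 hk
    push_cast
    nlinarith [mul_le_mul_of_nonneg_left ih hn, mul_le_mul_of_nonneg_left h4 hn,
      mul_le_mul_of_nonneg_left h5 hn, mul_nonneg hn hp, mul_nonneg hk (mul_nonneg hn hp)]

theorem abs_choose_sub_le {n : ℕ} (hn : 0 < n) (k : ℕ) :
    |(n.choose k : ℝ) - (n : ℝ) ^ k / k !| ≤ (k : ℝ) ^ 2 * (n : ℝ) ^ k / n := by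
  have hn' : (0 : ℝ) < n := Nat.cast_pos.2 hn
  have h1 := descFactorial_pow_bound n k
  have h2 : (n.descFactorial k : ℝ) ≤ (n : ℝ) ^ k := by exact_mod_cast Nat.descFactorial_le_pow n k
  have hk : (1 : ℝ) ≤ k ! := by exact_mod_cast Nat.factorial_pos k
  have h3 : (n.choose k : ℝ) - (n : ℝ) ^ k / k ! = -(((n : ℝ) ^ k - n.descFactorial k) / k !) := by
    rw [Nat.descFactorial_eq_factorial_mul_choose, Nat.cast_mul]; field_simp; ring
  rw [h3, abs_neg, abs_of_nonneg (div_nonneg (by linarith) (by positivity)), le_div_iff₀' hn']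
  refine le_trans ?_ h1
  exact mul_le_mul_of_nonneg_left (div_le_self (by linarith) hk) hn'.le

/-- The normalized `U`-statistic. -/
noncomputable def normStat (G : (Fin m → Bool) → ℝ) (n : ℕ) (ξ : Fin n → Bool) : ℝ :=
  (uStat G n ξ - cubeAvg G * (n : ℝ) ^ m / m !) / ((n : ℝ) ^ m / Real.sqrt n)

/-- The normalized bias of a `U`-statistic. -/
noncomputable def normBias (G : (Fin m → Bool) → ℝ) (n : ℕ) : ℝ :=
  (cubeAvg (uStat G n) - cubeAvg G * (n : ℝ) ^ m / m !) / ((n : ℝ) ^ m / Real.sqrt n)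

/-- The exact mean has `n.choose m` in place of n^m/m!; the discrepancy is O(n^(m-1)), half a power
below the normalization. -/
theorem abs_normBias_le {G : (Fin m → Bool) → ℝ} (hG : ∀ ζ, |G ζ| ≤ 1) {n : ℕ} (hn : 0 < n) :
    |normBias G n| ≤ (m : ℝ) ^ 2 / Real.sqrt n := by
  have hn' : (0 : ℝ) < n := Nat.cast_pos.2 hn
  have hs : 0 < Real.sqrt n := Real.sqrt_pos.2 hn'
  have e : cubeAvg (uStat G n) - cubeAvg G * (n : ℝ) ^ m / m ! =
      cubeAvg G * ((n.choose m : ℝ) - (n : ℝ) ^ m / m !) := by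
    rw [cubeAvg_uStat]; ring
  rw [normBias, e, abs_div, abs_mul, abs_of_pos (by positivity : 0 < (n : ℝ) ^ m / Real.sqrt n),
    div_le_div_iff₀ (by positivity) hs]
  have h1 := mul_le_mul (abs_cubeAvg_le hG) (abs_choose_sub_le hn m) (abs_nonneg _) zero_le_one
  calc _ ≤ 1 * ((m : ℝ) ^ 2 * (n : ℝ) ^ m / n) * Real.sqrt n := by gcongr
    _ = (m : ℝ) ^ 2 * ((n : ℝ) ^ m / Real.sqrt n) := by
      rw [one_mul, div_mul_eq_mul_div, div_eq_iff hn'.ne']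
      field_simp
      rw [Real.sq_sqrt hn'.le]

/-- After normalization each difference is at most m/√n, so their squared bounds sum to m² whatever
`n` is. The bias is at most m². -/
theorem cubeAvg_normStat_pow_le {G : (Fin m → Bool) → ℝ} (hG : ∀ ζ, |G ζ| ≤ 1) {n : ℕ}
    (hn : 0 < n) (k : ℕ) : cubeAvg (fun ξ => normStat G n ξ ^ (2 * k)) ≤
      2 ^ (2 * k - 1) * (2 * (2 * k)! * Real.exp ((m : ℝ) ^ 2 / 2) + ((m : ℝ) ^ 2) ^ (2 * k)) := by
  have hn' : (0 : ℝ) < n := Nat.cast_pos.2 hn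
  have hs : 0 < Real.sqrt n := Real.sqrt_pos.2 hn'
  have hs1 : 1 ≤ Real.sqrt n := Real.one_le_sqrt.2 (by exact_mod_cast hn)
  set r : ℝ := ((n : ℝ) ^ m / Real.sqrt n)⁻¹ with hr
  have hrpos : 0 < r := by positivity
  set F : (Fin n → Bool) → ℝ := fun ξ => r * uStat G n ξ with hF
  have hdec : ∀ ξ, normStat G n ξ = (F ξ - cubeAvg F) + normBias G n := by
    intro ξ
    simp only [hF, cubeAvg_const_mul, normStat, normBias, div_eq_mul_inv _ ((n : ℝ) ^ m / _), ← hr]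
    ring
  have hD : ∀ i ξ, |cubeDeriv i F ξ| ≤ m / Real.sqrt n := by
    intro i ξ
    rw [hF, cubeDeriv_const_mul, abs_mul, abs_of_pos hrpos]
    refine (mul_le_mul_of_nonneg_left (abs_cubeDeriv_uStat_le hG i ξ) hrpos.le).trans_eq ?_
    rw [hr]
    field_simp
    rw [Real.sq_sqrt hn'.le, mul_comm]
  have h1 := cubeAvg_pow_le F (fun _ => m / Real.sqrt n) hD k
  have h2 : ∑ _i : Fin n, (m / Real.sqrt n) ^ 2 = (m : ℝ) ^ 2 := by
    rw [Finset.sum_const, Finset.card_univ, Fintype.card_fin, nsmul_eq_mul, div_pow,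
      Real.sq_sqrt hn'.le]
    field_simp
  rw [h2] at h1
  have hb : normBias G n ^ (2 * k) ≤ ((m : ℝ) ^ 2) ^ (2 * k) := by
    rw [← (even_two_mul k).pow_abs]
    exact pow_le_pow_left₀ (abs_nonneg _)
      ((abs_normBias_le hG hn).trans (div_le_self (by positivity) hs1)) _
  have h3 : ∀ ξ, normStat G n ξ ^ (2 * k) ≤
      2 ^ (2 * k - 1) * ((F ξ - cubeAvg F) ^ (2 * k) + ((m : ℝ) ^ 2) ^ (2 * k)) := by
    intro ξ
    rw [hdec]
    refine ((even_two_mul k).add_pow_le).trans ?_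
    gcongr
  refine (cubeAvg_mono h3).trans ?_
  rw [cubeAvg_const_mul, cubeAvg_add, cubeAvg_const]
  gcongr

/-- The error is the rescaled nonlinear remainder plus the bias; by (a + b)² ≤ 2a² + 2b² each
accounts for 2m⁴/n. -/
theorem cubeAvg_sq_normStat_sub_le {G : (Fin m → Bool) → ℝ} (hG : ∀ ζ, |G ζ| ≤ 1) {n : ℕ}
    (hn : 0 < n) : cubeAvg (fun ξ => (normStat G n ξ -
      ∑ i, cubeAvg (cubeDeriv i (uStat G n)) / ((n : ℝ) ^ m / Real.sqrt n) * sgn (ξ i)) ^ 2) ≤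
      4 * (m : ℝ) ^ 4 / n := by
  have hn' : (0 : ℝ) < n := Nat.cast_pos.2 hn
  have hs : 0 < Real.sqrt n := Real.sqrt_pos.2 hn'
  set r : ℝ := ((n : ℝ) ^ m / Real.sqrt n)⁻¹ with hr
  have hrpos : 0 < r := by positivity
  set R : (Fin n → Bool) → ℝ := fun ξ => uStat G n ξ - cubeAvg (uStat G n) -
      ∑ i, cubeAvg (cubeDeriv i (uStat G n)) * sgn (ξ i) with hR
  have h1 : ∀ ξ, (normStat G n ξ -
      ∑ i, cubeAvg (cubeDeriv i (uStat G n)) / ((n : ℝ) ^ m / Real.sqrt n) * sgn (ξ i)) ^ 2 ≤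
      2 * r ^ 2 * R ξ ^ 2 + 2 * normBias G n ^ 2 := by
    intro ξ
    have e : normStat G n ξ -
        ∑ i, cubeAvg (cubeDeriv i (uStat G n)) / ((n : ℝ) ^ m / Real.sqrt n) * sgn (ξ i) =
        r * R ξ + normBias G n := by
      have : ∑ i, cubeAvg (cubeDeriv i (uStat G n)) / ((n : ℝ) ^ m / Real.sqrt n) * sgn (ξ i) =
          r * ∑ i, cubeAvg (cubeDeriv i (uStat G n)) * sgn (ξ i) := by
        rw [Finset.mul_sum]
        refine Finset.sum_congr rfl fun i _ => ?_
        rw [div_eq_mul_inv, ← hr]; ring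
      rw [this, hR, normStat, normBias]
      simp only [div_eq_mul_inv _ ((n : ℝ) ^ m / _), ← hr]
      ring
    rw [e]
    nlinarith [sq_nonneg (r * R ξ - normBias G n)]
  refine (cubeAvg_mono h1).trans ?_
  rw [cubeAvg_add, cubeAvg_const_mul, cubeAvg_const]
  have h2 : 2 * r ^ 2 * cubeAvg (fun ξ => R ξ ^ 2) ≤ 2 * (m : ℝ) ^ 4 / n := by
    refine (mul_le_mul_of_nonneg_left (cubeAvg_sq_uStat_sub_linear_le hG n)
      (by positivity)).trans_eq ?_
    rw [hr, inv_pow, div_pow, Real.sq_sqrt hn'.le]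
    field_simp
  have h3 : 2 * normBias G n ^ 2 ≤ 2 * (m : ℝ) ^ 4 / n := by
    have := pow_le_pow_left₀ (abs_nonneg _) (abs_normBias_le hG hn) 2
    rw [sq_abs, div_pow, Real.sq_sqrt hn'.le] at this
    calc 2 * normBias G n ^ 2 ≤ 2 * (((m : ℝ) ^ 2) ^ 2 / n) := by gcongr
      _ = _ := by ring
  calc _ ≤ 2 * (m : ℝ) ^ 4 / n + 2 * (m : ℝ) ^ 4 / n := add_le_add h2 h3
    _ = _ := by ring

/-- The characteristic functions of a normalized `U`-statistic converge. -/
theorem tendsto_cubeAvg_cexp_normStat (hm : 1 ≤ m) {G : (Fin m → Bool) → ℝ}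
    (hG : ∀ ζ, |G ζ| ≤ 1) (t : ℝ) :
    Tendsto (fun n => cubeAvg (fun ξ : Fin n → Bool =>
      Complex.exp (t * (normStat G n ξ : ℝ) * Complex.I))) atTop
      (𝓝 (Real.exp (-(t ^ 2 *
        (∫ x in (0 : ℝ)..1, limCoeff (fun k => cubeAvg (cubeDeriv k G)) x ^ 2) / 2)) : ℝ)) := by
  set c : Fin m → ℝ := fun k => cubeAvg (cubeDeriv k G) with hc
  set b : ∀ n : ℕ, Fin n → ℝ := fun n i =>
    cubeAvg (cubeDeriv i (uStat G n)) / ((n : ℝ) ^ m / Real.sqrt n) with hb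
  have hsq : Tendsto (fun n : ℕ => Real.sqrt n) atTop atTop :=
    Real.tendsto_sqrt_atTop.comp tendsto_natCast_atTop_atTop
  have hbe : ∀ n : ℕ, 0 < n → ∀ i : Fin n,
      b n i = linCoeff c n i / (n : ℝ) ^ (m - 1) / Real.sqrt n := by
    intro n hn i
    have hn' : (0 : ℝ) < n := Nat.cast_pos.2 hn
    have hs : 0 < Real.sqrt n := Real.sqrt_pos.2 hn'
    obtain ⟨m, rfl⟩ : ∃ m', m = m' + 1 := ⟨m - 1, by omega⟩
    simp only [hb, cubeAvg_cubeDeriv_uStat, linCoeff, hc, pow_succ, Nat.add_sub_cancel]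
    field_simp
    rw [Real.sq_sqrt hn'.le]
  have h1 : Tendsto (fun n => ∑ i, b n i ^ 2) atTop
      (𝓝 (∫ x in (0 : ℝ)..1, limCoeff c x ^ 2)) := by
    refine (tendsto_sum_sq_linCoeff c).congr' ?_
    filter_upwards [eventually_gt_atTop 0] with n hn
    rw [Finset.sum_div]
    refine Finset.sum_congr rfl fun i _ => ?_
    rw [hbe n hn, div_pow _ (Real.sqrt n), Real.sq_sqrt (Nat.cast_nonneg n)]
  have h2 := tendsto_cubeAvg_cexp_linear b h1 (δ := fun n => (∑ k, |c k|) / Real.sqrt n)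
    (hsq.const_div_atTop _) (by
      filter_upwards [eventually_gt_atTop 0] with n hn i
      rw [hbe n hn, abs_div, abs_of_nonneg (Real.sqrt_nonneg _)]
      exact div_le_div_of_nonneg_right (abs_linCoeff_div_le c i.isLt) (Real.sqrt_nonneg _)) t
  have h3 : Tendsto (fun n => cubeAvg (fun ξ : Fin n → Bool =>
      Complex.exp (t * (normStat G n ξ : ℝ) * Complex.I)) - cubeAvg (fun ξ : Fin n → Bool =>
      Complex.exp (t * (∑ i, b n i * sgn (ξ i) : ℝ) * Complex.I))) atTop (𝓝 0) := by
    have h4 : Tendsto (fun n : ℕ => |t| * Real.sqrt (4 * (m : ℝ) ^ 4 / n)) atTop (𝓝 0) := by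
      have := ((Real.continuous_sqrt.tendsto _).comp
        (tendsto_const_div_atTop_nhds_zero_nat (4 * (m : ℝ) ^ 4))).const_mul |t|
      simpa using this
    refine squeeze_zero_norm' ?_ h4
    filter_upwards [eventually_gt_atTop 0] with n hn
    refine (norm_cubeAvg_cexp_sub_le _ _ t).trans ?_
    gcongr
    exact cubeAvg_sq_normStat_sub_le hG hn
  simpa using h3.add h2

end UStatisticLimit

/-! ### Avoiders as binary codes -/

section Codes

variable {m n : ℕ}

theorem lt_iff_lt_of_forall_lt {α β ι : Type*} [LinearOrder α] [LinearOrder β] [LinearOrder ι]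
    {f : ι → α} {g : ι → β} (hf : Function.Injective f) (hg : Function.Injective g)
    (h : ∀ j k, j < k → (f j < f k ↔ g j < g k)) (j k : ι) : f j < f k ↔ g j < g k := by
  rcases lt_trichotomy j k with hjk | rfl | hjk
  · exact h j k hjk
  · simp
  · have := not_congr (h k j hjk)
    rw [not_lt, not_lt] at this
    constructor
    · exact fun hl => lt_of_le_of_ne (this.1 hl.le) (hg.ne hjk.ne')
    · exact fun hl => lt_of_le_of_ne (this.2 hl.le) (hf.ne hjk.ne')

theorem perm_val_eq_card (π : Equiv.Perm (Fin n)) (j : Fin n) :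
    (π j : ℕ) = (Finset.univ.filter fun i => π i < π j).card := by
  have h : (Finset.univ.filter fun i => π i < π j).map π.toEmbedding = Finset.Iio (π j) := by
    ext x
    simp only [Finset.mem_map_equiv, Finset.mem_filter, Finset.mem_univ, true_and,
      Equiv.apply_symm_apply, Finset.mem_Iio]
  rw [← Finset.card_map π.toEmbedding, h, Fin.card_Iio]

/-- Each value is the number of smaller entries, so the relative order determines the permutation.
-/
theorem perm_ext_of_lt_iff {π π' : Equiv.Perm (Fin n)}
    (h : ∀ j k, j < k → (π j < π k ↔ π' j < π' k)) : π = π' := by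
  refine Equiv.ext fun j => Fin.ext ?_
  rw [perm_val_eq_card, perm_val_eq_card]
  simp only [lt_iff_lt_of_forall_lt π.injective π'.injective h]

theorem occ_ne_zero_of_three {τ : Equiv.Perm (Fin 3)} {π : Equiv.Perm (Fin n)} {i j k : Fin n}
    (hij : i < j) (hjk : j < k) (h01 : π i < π j ↔ τ 0 < τ 1) (h02 : π i < π k ↔ τ 0 < τ 2)
    (h12 : π j < π k ↔ τ 1 < τ 2) : occ τ π ≠ 0 := by
  have he : StrictMono ![i, j, k] := by
    intro a b hab
    fin_cases a <;> fin_cases b <;>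
      first | exact absurd hab (by decide) | exact hij | exact hjk | exact hij.trans hjk
  refine (Finset.card_pos.2 ⟨![i, j, k], Finset.mem_filter.2 ⟨Finset.mem_univ _,
    fun _ _ h => he h, ?_⟩⟩).ne'
  refine lt_iff_lt_of_forall_lt (f := fun a => π (![i, j, k] a)) (g := τ)
    (π.injective.comp he.injective) τ.injective fun a b hab => ?_
  fin_cases a <;> fin_cases b <;>
    first | exact absurd hab (by decide) | exact h01 | exact h12 | exact h02

/-- Both patterns end in their middle value, preceded by the extremes in either order. Avoiding both
means that no entry lies between two earlier values. -/
theorem mem_avoiders_iff {π : Equiv.Perm (Fin n)} :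
    π ∈ avoiders n ↔ ∀ i j k, i < k → j < k → ¬(π i < π k ∧ π k < π j) := by
  constructor
  · rintro ⟨h132, h312⟩ i j k hik hjk ⟨h1, h2⟩
    rcases lt_trichotomy i j with hij | rfl | hij
    · exact occ_ne_zero_of_three hij hjk (iff_of_true (h1.trans h2) (by decide))
        (iff_of_true h1 (by decide)) (iff_of_false h2.not_gt (by decide)) h132
    · exact lt_asymm h1 h2
    · exact occ_ne_zero_of_three hij hik (iff_of_false (h1.trans h2).not_gt (by decide))
        (iff_of_false h2.not_gt (by decide)) (iff_of_true h1 (by decide)) h312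
  · intro h
    constructor
    · refine Finset.card_eq_zero.mpr (Finset.filter_eq_empty_iff.mpr ?_)
      rintro e - ⟨he, hp⟩
      exact h (e 0) (e 1) (e 2) (he 0 2 (by decide)) (he 1 2 (by decide))
        ⟨(hp 0 2).2 (by decide), (hp 2 1).2 (by decide)⟩
    · refine Finset.card_eq_zero.mpr (Finset.filter_eq_empty_iff.mpr ?_)
      rintro e - ⟨he, hp⟩
      exact h (e 1) (e 0) (e 2) (he 1 2 (by decide)) (he 0 2 (by decide))
        ⟨(hp 1 2).2 (by decide), (hp 2 0).2 (by decide)⟩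

/-- The bits of the code of a permutation. -/
def bits (π : Equiv.Perm (Fin n)) (k : Fin n) : Bool := decide (∀ i, i < k → π i < π k)

theorem sgn_bits (π : Equiv.Perm (Fin n)) (k : Fin n) : sgn (bits π k) = code π k := by
  simp only [sgn, bits, code, decide_eq_true_eq]
  split_ifs <;> simp

/-- An entry above one earlier entry is above all of them, as it would otherwise lie between two. -/
theorem lt_iff_bits {π : Equiv.Perm (Fin n)} (hπ : π ∈ avoiders n) {j k : Fin n} (hjk : j < k) :
    π j < π k ↔ bits π k = true := by
  rw [bits, decide_eq_true_eq]
  refine ⟨fun h i hi => ?_, fun h => h j hjk⟩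
  by_contra hcon
  exact mem_avoiders_iff.1 hπ j i k hjk hi
    ⟨h, lt_of_le_of_ne (not_lt.1 hcon) (π.injective.ne hi.ne')⟩

/-- Integers in the same relative order as the permutation with code `ξ`. -/
def codeHeight (ξ : Fin n → Bool) (j : Fin n) : ℤ := if ξ j then (j : ℤ) else -(j : ℤ)

/-- The absolute value of a height is its position, so the sign of the later height decides the
comparison. -/
theorem codeHeight_lt_iff (ξ : Fin n → Bool) {j k : Fin n} (hjk : j < k) :
    codeHeight ξ j < codeHeight ξ k ↔ ξ k = true := by
  have : (j : ℕ) < k := hjk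
  simp only [codeHeight]
  cases ξ j <;> cases ξ k <;> simp <;> omega

theorem codeHeight_injective (ξ : Fin n → Bool) : Function.Injective (codeHeight ξ) := by
  intro j k h
  simp only [codeHeight] at h
  ext
  split_ifs at h <;> omega

/-- The rank of a position in the permutation with code `ξ`. -/
def codeRank (ξ : Fin n → Bool) (j : Fin n) : Fin n :=
  ⟨(Finset.univ.filter fun i => codeHeight ξ i < codeHeight ξ j).card, by
    refine (Finset.card_lt_card (Finset.filter_ssubset.2 ⟨j, Finset.mem_univ _, ?_⟩)).trans_eq ?_
    · simp
    · simp⟩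

theorem codeRank_lt {ξ : Fin n → Bool} {j k : Fin n} (h : codeHeight ξ j < codeHeight ξ k) :
    codeRank ξ j < codeRank ξ k := by
  rw [codeRank, codeRank, Fin.mk_lt_mk]
  refine Finset.card_lt_card (Finset.ssubset_iff_of_subset (fun i hi => ?_) |>.2 ⟨j, ?_, ?_⟩)
  · simp only [Finset.mem_filter, Finset.mem_univ, true_and] at hi ⊢
    exact hi.trans h
  · simpa using h
  · simp

theorem codeRank_lt_iff {ξ : Fin n → Bool} {j k : Fin n} :
    codeRank ξ j < codeRank ξ k ↔ codeHeight ξ j < codeHeight ξ k := by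
  refine ⟨fun h => ?_, codeRank_lt⟩
  by_contra hcon
  rcases (not_lt.1 hcon).lt_or_eq with h' | h'
  · exact lt_asymm h (codeRank_lt h')
  · rw [codeHeight_injective ξ h'] at h
    exact lt_irrefl _ h

theorem codeRank_injective (ξ : Fin n → Bool) : Function.Injective (codeRank ξ) := by
  intro j k h
  by_contra hjk
  rcases lt_or_gt_of_ne ((codeHeight_injective ξ).ne hjk) with h' | h'
  · exact (codeRank_lt h').ne h
  · exact (codeRank_lt h').ne' h

/-- The permutation with code `ξ`. -/
noncomputable def codePerm (ξ : Fin n → Bool) : Equiv.Perm (Fin n) :=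
  Equiv.ofBijective (codeRank ξ) (Finite.injective_iff_bijective.1 (codeRank_injective ξ))

theorem codePerm_lt_iff (ξ : Fin n → Bool) {j k : Fin n} (hjk : j < k) :
    codePerm ξ j < codePerm ξ k ↔ ξ k = true := by
  rw [← codeHeight_lt_iff ξ hjk]
  exact codeRank_lt_iff

theorem codePerm_mem_avoiders (ξ : Fin n → Bool) : codePerm ξ ∈ avoiders n := by
  rw [mem_avoiders_iff]
  rintro i j k hik hjk ⟨h1, h2⟩
  exact lt_asymm h2 ((codePerm_lt_iff ξ hjk).2 ((codePerm_lt_iff ξ hik).1 h1))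

theorem codePerm_bits {π : Equiv.Perm (Fin n)} (hπ : π ∈ avoiders n) : codePerm (bits π) = π :=
  perm_ext_of_lt_iff fun j k hjk => by rw [codePerm_lt_iff _ hjk, lt_iff_bits hπ hjk]

theorem codePerm_eq_iff {ξ ξ' : Fin n → Bool} :
    codePerm ξ = codePerm ξ' ↔ ∀ k : Fin n, 0 < (k : ℕ) → ξ k = ξ' k := by
  constructor
  · intro h k hk
    have hjk : (⟨0, by omega⟩ : Fin n) < k := hk
    rw [Bool.eq_iff_iff, ← codePerm_lt_iff ξ hjk, ← codePerm_lt_iff ξ' hjk, h]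
  · intro h
    refine perm_ext_of_lt_iff fun j k hjk => ?_
    have : (j : ℕ) < k := hjk
    rw [codePerm_lt_iff _ hjk, codePerm_lt_iff _ hjk, h k (by omega)]

end Codes

/-! ### Uniform avoiders as uniform points of the cube -/

section Transfer

/-- The first bit is irrelevant and the others determine the avoider, so the cube covers the
avoiders exactly two to one. -/
theorem integral_uniformAvoider {K : Type*} [RCLike K] {n : ℕ} (hn : 0 < n)
    (g : Equiv.Perm (Fin n) → K) :
    ∫ π, g π ∂uniformAvoider n = cubeAvg (fun ξ => g (codePerm ξ)) := by
  classical
  obtain ⟨N, rfl⟩ : ∃ N, n = N + 1 := ⟨n - 1, by omega⟩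
  set S : Finset (Equiv.Perm (Fin (N + 1))) := Finset.univ.filter (· ∈ avoiders (N + 1)) with hS
  have hSc : (S : Set (Equiv.Perm (Fin (N + 1)))) = avoiders (N + 1) := by simp [hS]
  have hmem : ∀ ζ ∈ (Finset.univ : Finset (Fin N → Bool)),
      codePerm (Fin.cons true ζ : Fin (N + 1) → Bool) ∈ S := fun ζ _ =>
    Finset.mem_filter.2 ⟨Finset.mem_univ _, codePerm_mem_avoiders _⟩
  have hinj : ∀ ζ ∈ (Finset.univ : Finset (Fin N → Bool)), ∀ ζ' ∈ Finset.univ,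
      codePerm (Fin.cons true ζ : Fin (N + 1) → Bool) = codePerm (Fin.cons true ζ') → ζ = ζ' := by
    intro ζ _ ζ' _ h
    funext k
    simpa using codePerm_eq_iff.1 h k.succ (by simp)
  have hsurj : ∀ π ∈ S, ∃ ζ, ∃ _ : ζ ∈ (Finset.univ : Finset (Fin N → Bool)),
      codePerm (Fin.cons true ζ : Fin (N + 1) → Bool) = π := by
    intro π hπ
    refine ⟨fun k => bits π k.succ, Finset.mem_univ _, ?_⟩
    conv_rhs => rw [← codePerm_bits (Finset.mem_filter.1 hπ).2]
    rw [codePerm_eq_iff]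
    intro k hk
    obtain ⟨k, rfl⟩ := Fin.exists_succ_eq.2 (fun h => by simp [h] at hk : k ≠ 0)
    simp
  have hcard : S.card = 2 ^ N := by
    rw [← Finset.card_bij (fun ζ _ => codePerm (Fin.cons true ζ : Fin (N + 1) → Bool)) hmem
      (fun ζ h ζ' h' => hinj ζ h ζ' h') hsurj]
    simp
  have hsum : ∑ π ∈ S, g π = ∑ ζ : Fin N → Bool, g (codePerm (Fin.cons true ζ)) :=
    (Finset.sum_bij (fun ζ _ => codePerm (Fin.cons true ζ : Fin (N + 1) → Bool)) hmem
      (fun ζ h ζ' h' => hinj ζ h ζ' h') hsurj fun _ _ => rfl).symm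
  have hfalse : ∀ ζ : Fin N → Bool, codePerm (Fin.cons false ζ : Fin (N + 1) → Bool) =
      codePerm (Fin.cons true ζ) := by
    intro ζ
    rw [codePerm_eq_iff]
    intro k hk
    obtain ⟨k, rfl⟩ := Fin.exists_succ_eq.2 (fun h => by simp [h] at hk : k ≠ 0)
    simp
  have hreal : ∀ π, (uniformAvoider (N + 1)).real {π} = if π ∈ S then ((2 : ℝ) ^ N)⁻¹ else 0 := by
    intro π
    rw [measureReal_def, uniformAvoider, ← hSc, ← Finset.coe_singleton, uniformOn_apply_finset,
      hcard]
    split_ifs with h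
    · rw [Finset.inter_singleton_of_mem h]; simp
    · rw [Finset.inter_singleton_of_notMem h]; simp
  rw [integral_fintype .of_finite]
  simp only [hreal, ite_smul, zero_smul]
  rw [← Finset.sum_filter, Finset.filter_mem_eq_inter, Finset.univ_inter, ← Finset.smul_sum, hsum,
    cubeAvg_cons]
  simp only [hfalse, cubeAvg]
  rw [RCLike.real_smul_eq_coe_mul]
  push_cast
  field_simp
  ring

end Transfer

/-! ### The pattern kernel and its variance -/

section Kernel

variable {m : ℕ}

/-- The kernel of the `U`-statistic that counts the occurrences of the pattern `σ`. -/
noncomputable def kernel (σ : Equiv.Perm (Fin m)) (ζ : Fin m → Bool) : ℝ :=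
  if ∀ k : Fin m, 0 < (k : ℕ) → ζ k = bits σ k then 1 else 0

theorem abs_kernel_le (σ : Equiv.Perm (Fin m)) (ζ : Fin m → Bool) : |kernel σ ζ| ≤ 1 := by
  unfold kernel; split_ifs <;> simp

/-- In both permutations the bit of the later position decides each comparison, so the relative
orders agree iff these bits do. -/
theorem occ_codePerm {σ : Equiv.Perm (Fin m)} (hσ : σ ∈ avoiders m) {n : ℕ} (ξ : Fin n → Bool) :
    (occ σ (codePerm ξ) : ℝ) = uStat (kernel σ) n ξ := by
  simp only [occ, uStat, kernel, Function.comp_apply]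
  rw [← Finset.sum_filter, Finset.sum_const, nsmul_one, increasingSeqs, Finset.filter_filter]
  refine congrArg _ (congrArg _ (Finset.filter_congr fun e _ => and_congr_right fun he => ?_))
  constructor
  · intro h k hk
    have hjk : (⟨0, by omega⟩ : Fin m) < k := hk
    rw [Bool.eq_iff_iff, ← codePerm_lt_iff ξ (he _ _ hjk), ← lt_iff_bits hσ hjk]
    exact h _ _
  · intro h
    have hem : StrictMono e := fun _ _ hjk => he _ _ hjk
    refine lt_iff_lt_of_forall_lt (f := fun j => codePerm ξ (e j)) (g := σ)
      ((codePerm ξ).injective.comp hem.injective) σ.injective fun j k hjk => ?_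
    have : (j : ℕ) < k := hjk
    rw [codePerm_lt_iff ξ (he _ _ hjk), lt_iff_bits hσ hjk, h k (by omega)]

/-- Summation by parts: pair each point with the one whose bit `k` is flipped. -/
theorem cubeAvg_cubeDeriv (k : Fin m) (f : (Fin m → Bool) → ℝ) :
    cubeAvg (cubeDeriv k f) = cubeAvg (fun ζ => sgn (ζ k) * f ζ) := by
  have hinv : Function.Involutive fun ζ : Fin m → Bool => Function.update ζ k (!ζ k) := by
    intro ζ; simp
  have h1 : ∀ ζ, cubeDeriv k f ζ = (sgn (ζ k) * f ζ +
      sgn (Function.update ζ k (!ζ k) k) * f (Function.update ζ k (!ζ k))) / 2 := by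
    intro ζ
    have hζ := Function.update_eq_self k ζ
    rw [Function.update_self, cubeDeriv]
    cases h : ζ k <;> rw [h] at hζ <;> simp only [hζ, sgn, Bool.not_true, Bool.not_false] <;>
      simp <;> ring
  have h2 := Equiv.sum_comp (hinv.toPerm _) (fun ζ => sgn (ζ k) * f ζ)
  simp only [Function.Involutive.coe_toPerm] at h2
  simp only [cubeAvg, h1, ← Finset.sum_div, Finset.sum_add_distrib, h2]
  ring

theorem kernel_cons {M : ℕ} (σ : Equiv.Perm (Fin (M + 1))) (b : Bool) (ζ : Fin M → Bool) :
    kernel σ (Fin.cons b ζ) = if ζ = fun k => bits σ k.succ then 1 else 0 := by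
  refine if_congr ?_ rfl rfl
  rw [Fin.forall_fin_succ]
  simp [funext_iff]

theorem cubeAvg_kernel (hm : 1 ≤ m) (σ : Equiv.Perm (Fin m)) :
    cubeAvg (kernel σ) = (2 : ℝ) ^ (1 - (m : ℤ)) := by
  obtain ⟨M, rfl⟩ : ∃ M, m = M + 1 := ⟨m - 1, by omega⟩
  rw [cubeAvg_cons]
  simp only [kernel_cons, cubeAvg, Finset.sum_ite_eq', Finset.mem_univ, if_true]
  rw [show (1 : ℤ) - ((M + 1 : ℕ) : ℤ) = -(M : ℤ) by push_cast; ring, zpow_neg, zpow_natCast]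
  ring

/-- On the support of the kernel the sign at a positive position is `code σ k`, so it factors out of
the mean; at position 0 both signs occur and cancel. -/
theorem cubeAvg_cubeDeriv_kernel (σ : Equiv.Perm (Fin m)) (k : Fin m) :
    cubeAvg (cubeDeriv k (kernel σ)) =
      if 0 < (k : ℕ) then (2 : ℝ) ^ (1 - (m : ℤ)) * code σ k else 0 := by
  obtain ⟨M, rfl⟩ : ∃ M, m = M + 1 := ⟨m - 1, by have := k.isLt; omega⟩
  rw [cubeAvg_cubeDeriv, cubeAvg_cons]
  simp only [kernel_cons]
  induction k using Fin.cases with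
  | zero => simp [cubeAvg, sgn, neg_div]
  | succ k =>
    simp only [Fin.cons_succ, cubeAvg, mul_ite, mul_one, mul_zero, Finset.sum_ite_eq',
      Finset.mem_univ, if_true, sgn_bits]
    rw [show (1 : ℤ) - ((M + 1 : ℕ) : ℤ) = -(M : ℤ) by push_cast; ring, zpow_neg, zpow_natCast]
    simp
    ring

/-- The prefactor of `gammaSq` is the square of the kernel mean, and the restriction to positive
indices reflects the vanishing coefficient at 0. -/
theorem gammaSq_eq_integral (σ : Equiv.Perm (Fin m)) : gammaSq σ =
    ∫ x in (0 : ℝ)..1, limCoeff (fun k => cubeAvg (cubeDeriv k (kernel σ))) x ^ 2 := by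
  rw [integral_sq_limCoeff, gammaSq, Finset.mul_sum]
  refine Finset.sum_congr rfl fun i _ => ?_
  rw [Finset.mul_sum]
  refine Finset.sum_congr rfl fun j _ => ?_
  rw [cubeAvg_cubeDeriv_kernel, cubeAvg_cubeDeriv_kernel]
  have h : (2 : ℝ) ^ (2 - 2 * (m : ℤ)) = (2 : ℝ) ^ (1 - (m : ℤ)) * (2 : ℝ) ^ (1 - (m : ℤ)) := by
    rw [← zpow_add₀ two_ne_zero]; congr 1; ring
  by_cases hi : 0 < (i : ℕ) <;> by_cases hj : 0 < (j : ℕ) <;> simp only [hi, hj, and_self,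
    and_true, and_false, if_true, if_false, mul_zero, zero_mul]
  rw [h]
  ring

theorem gammaSq_nonneg (σ : Equiv.Perm (Fin m)) : 0 ≤ gammaSq σ := by
  rw [gammaSq_eq_integral]
  exact intervalIntegral.integral_nonneg zero_le_one fun _ _ => sq_nonneg _

theorem gammaSq_pos (hm : 2 ≤ m) (σ : Equiv.Perm (Fin m)) : 0 < gammaSq σ := by
  rw [gammaSq_eq_integral]
  refine integral_sq_limCoeff_pos _ hm ?_ ?_
  · rw [cubeAvg_cubeDeriv_kernel]; simp
  · rw [cubeAvg_cubeDeriv_kernel, if_pos one_pos]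
    refine mul_ne_zero (zpow_ne_zero _ two_ne_zero) ?_
    rw [code]
    split_ifs <;> simp

theorem normalizedOcc_codePerm (hm : 1 ≤ m) {σ : Equiv.Perm (Fin m)} (hσ : σ ∈ avoiders m) {n : ℕ}
    (hn : 0 < n) (ξ : Fin n → Bool) :
    normalizedOcc σ n (codePerm ξ) = normStat (kernel σ) n ξ := by
  rw [normalizedOcc, normStat, occ_codePerm hσ, cubeAvg_kernel hm,
    Real.rpow_sub (Nat.cast_pos.2 hn), Real.rpow_natCast, Real.sqrt_eq_rpow]

theorem tendstoInDistribution_normalizedOcc (hm : 1 ≤ m) {σ : Equiv.Perm (Fin m)}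
    (hσ : σ ∈ avoiders m) :
    TendstoInDistribution (fun n => normalizedOcc σ n) atTop (id : ℝ → ℝ)
      uniformAvoider (gaussianReal 0 (gammaSq σ).toNNReal) where
  forall_aemeasurable n := measurable_from_top.aemeasurable
  tendsto := by
    refine ProbabilityMeasure.tendsto_of_tendsto_charFun fun t => ?_
    simp only [ProbabilityMeasure.coe_mk, Measure.map_id, charFun_gaussianReal]
    have h := tendsto_cubeAvg_cexp_normStat hm (abs_kernel_le σ) t
    rw [← gammaSq_eq_integral] at h
    have e : Complex.exp (t * (0 : ℝ) * Complex.I - (gammaSq σ).toNNReal * t ^ 2 / 2) =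
        ((Real.exp (-(t ^ 2 * gammaSq σ / 2)) : ℝ) : ℂ) := by
      have : (((gammaSq σ).toNNReal : ℝ) : ℂ) = (gammaSq σ : ℂ) := by
        rw [Real.coe_toNNReal _ (gammaSq_nonneg σ)]
      push_cast
      rw [this]
      congr 1; ring
    rw [e]
    refine h.congr' ?_
    filter_upwards [eventually_gt_atTop 0] with n hn
    rw [charFun_apply_real, integral_map measurable_from_top.aemeasurable
      (by fun_prop : Continuous _).aestronglyMeasurable, integral_uniformAvoider hn]
    simp only [normalizedOcc_codePerm hm hσ hn]

end Kernel

end PatternCount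

theorem mainTheorem1 (m : ℕ) (hm : 1 ≤ m) (σ : Equiv.Perm (Fin m))
    (hσ : σ ∈ PatternCount.avoiders m) :
    0 ≤ PatternCount.gammaSq σ ∧
    (2 ≤ m → 0 < PatternCount.gammaSq σ) ∧
    TendstoInDistribution (fun n => PatternCount.normalizedOcc σ n) atTop (id : ℝ → ℝ)
      PatternCount.uniformAvoider (gaussianReal 0 (PatternCount.gammaSq σ).toNNReal) ∧
    ∀ k : ℕ, Tendsto
      (fun n : ℕ => ∫ π, PatternCount.normalizedOcc σ n π ^ k ∂PatternCount.uniformAvoider n)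
      atTop (𝓝 (∫ x, x ^ k ∂gaussianReal 0 (PatternCount.gammaSq σ).toNNReal)) := by
  have hdist := PatternCount.tendstoInDistribution_normalizedOcc hm hσ
  refine ⟨PatternCount.gammaSq_nonneg σ, fun h => PatternCount.gammaSq_pos h σ, hdist, fun k => ?_⟩
  have hmap : ∀ n k : ℕ, ∫ x, x ^ k ∂(PatternCount.uniformAvoider n).map
      (PatternCount.normalizedOcc σ n) =
      ∫ π, PatternCount.normalizedOcc σ n π ^ k ∂PatternCount.uniformAvoider n := fun n k =>
    integral_map measurable_from_top.aemeasurable (by fun_prop : Continuous _).aestronglyMeasurable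
  have h := PatternCount.tendsto_integral_pow hdist.tendsto ?_ ?_ ?_ k
  · simpa only [ProbabilityMeasure.coe_mk, Measure.map_id, hmap] using h
  · intro n k
    exact (integrable_map_measure (by fun_prop : Continuous _).aestronglyMeasurable
      measurable_from_top.aemeasurable).2 .of_finite
  · intro k
    simp only [ProbabilityMeasure.coe_mk, Measure.map_id]
    -- Integrability from membership in Lᵏ needs a nonzero exponent; the zeroth power is constant.
    rcases Nat.eq_zero_or_pos k with rfl | hk
    · simp
    · refine (MemLp.integrable_norm_pow (memLp_id_gaussianReal k) hk.ne').mono'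
        (by fun_prop : Continuous _).aestronglyMeasurable (Eventually.of_forall fun x => ?_)
      simp
  · intro k
    refine ⟨2 ^ (2 * k - 1) * (2 * (2 * k)! * Real.exp ((m : ℝ) ^ 2 / 2) +
      ((m : ℝ) ^ 2) ^ (2 * k)), ?_⟩
    filter_upwards [eventually_gt_atTop 0] with n hn
    simp only [ProbabilityMeasure.coe_mk, hmap]
    rw [PatternCount.integral_uniformAvoider hn]
    simp only [PatternCount.normalizedOcc_codePerm hm hσ hn]
    exact PatternCount.cubeAvg_normStat_pow_le (PatternCount.abs_kernel_le σ) hn k
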